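/- Let $K$ be a real quadratic field with discriminant $D$ and ring of integers $\mathcal{O}_K$, and fix a square root $\sqrt{D}\in K$. Let $\mathcal{C}(K)$ be the narrow class group of $\mathcal{O}_K$ (fractional ideals modulo principal ideals generated by totally positive elements). Let $N\geq 5$ be a prime not dividing $D$, and let $\mathfrak{N}$ be a prime ideal of $\mathcal{O}_K$ of the form $\mathfrak{N}=\left(N,\frac{-\delta+\sqrt{D}}{2}\right)$ with $\delta\in\mathbf{Z}$ and $\delta^2\equiv D \pmod N$. Let $\varepsilon=u+v\sqrt{D}$ ($u,v\in\mathbf{Q}$) be a fundamental unit of norm $1$, i.e. a unit of norm $1$ such that every unit of $\mathcal{O}_K$ of norm $1$ is of the form $\pm\varepsilon^n$ with $n \in \mathbf{Z}$. Let $X_0(N)=\Gamma_0(N)\backslash(\mathfrak{h}\cup\mathbf{P}^1(\mathbf{Q}))$ be the compact modular curve, $W_N$ its Atkin--Lehner involution, induced by $z\mapsto -1/(Nz)$, and $c$ its complex conjugation, induced by $z\mapsto-\bar z$; both act on $H_1(X_0(N),\mathbf{Z})$ by push-forward, and $\mathbf{C}$-linearly on $H_1(X_0(N),\mathbf{Z})\otimes_{\mathbf{Z}}\mathbf{C}$.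 For a narrow ideal class, choose a representative of the form $I=\left(A,\frac{-B+\sqrt{D}}{2}\right)$ with $A,B,C\in\mathbf{Z}$, $A>0$, $N\mid A$, $N^2\nmid A$, $B\equiv\delta\pmod N$ and $B^2-4AC=D$, and let $\gamma_I\in H_1(X_0(N),\mathbf{Z})$ be the homology class of the image in $X_0(N)$ of a path in $\mathfrak{h}$ from a point $z$ to $M_Iz$, where $$M_I=\begin{pmatrix}u-Bv&-2Cv\\2Av&u+Bv\end{pmatrix}\in\Gamma_0(N).$$ Then such an $I$ exists in every class of $\mathcal{C}(K)$, and $\gamma_I$ depends only on this class (not on $A,B,C$, on $z$ or on the path). Moreover, for every character $\chi:\mathcal{C}(K)\to\mathbf{C}^\times$, the element $$[\chi]:=\sum_{[I]\in\mathcal{C}(K)}\chi^{-1}(I)\cdot\gamma_I\in H_1(X_0(N),\mathbf{Z})\otimes_{\mathbf{Z}}\mathbf{C}$$ satisfies $$\overline{[\chi]}=-\chi(\mathfrak{N})\cdot W_N\,c([\chi]),$$ where $\overline{[\chi]}$ is obtained from $[\chi]$ by complex conjugation of the coefficients in $\mathbf{C}$. -/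

import Mathlib

open scoped MatrixGroups nonZeroDivisors NumberField TensorProduct CategoryTheory
open scoped UpperHalfPlane

noncomputable section

/-! ### First singular homology and classes of loops -/

/-- The first singular homology group `H₁(X, ℤ)` of a topological space. -/
def H1 (X : Type) [TopologicalSpace X] : Type :=
  ((AlgebraicTopology.singularHomologyFunctor (ModuleCat.{0} ℤ) 1).obj
    (ModuleCat.of ℤ ℤ)).obj (TopCat.of X)

instance (X : Type) [TopologicalSpace X] : AddCommGroup (H1 X) :=
  inferInstanceAs (AddCommGroup
    (((AlgebraicTopology.singularHomologyFunctor (ModuleCat.{0} ℤ) 1).obj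
      (ModuleCat.of ℤ ℤ)).obj (TopCat.of X) : ModuleCat.{0} ℤ))

/-- The map `f_* : H₁(X, ℤ) → H₁(Y, ℤ)` induced by a continuous map `f : X → Y`. -/
def H1.map {X Y : Type} [TopologicalSpace X] [TopologicalSpace Y] (f : C(X, Y)) :
    H1 X →+ H1 Y :=
  (((AlgebraicTopology.singularHomologyFunctor (ModuleCat.{0} ℤ) 1).obj
    (ModuleCat.of ℤ ℤ)).map (TopCat.ofHom f)).hom.toAddMonoidHom

/-- A path, seen as a singular `1`-simplex from its source (vertex `0`) to its target
(vertex `1`). -/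
def pathSimplex {X : Type} [TopologicalSpace X] {x y : X} (p : Path x y) :
    (TopCat.toSSet.obj (TopCat.of X)).obj (Opposite.op (SimplexCategory.mk 1)) :=
  (TopCat.toSSetObjEquiv (TopCat.of X) _).symm
    (p.toContinuousMap.comp
      ⟨stdSimplexHomeomorphUnitInterval, stdSimplexHomeomorphUnitInterval.continuous⟩)

theorem pathSimplex_boundary {X : Type} [TopologicalSpace X] {x : X} (p : Path x x) :
    SSet.ιChainComplex (R := ModuleCat.of ℤ ℤ) (TopCat.toSSet.obj (TopCat.of X)) (pathSimplex p) ≫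
      ((TopCat.toSSet.obj (TopCat.of X)).chainComplex (ModuleCat.of ℤ ℤ)).d 1 0 = 0 := by
  have h : (TopCat.toSSet.obj (TopCat.of X)).δ 0 (pathSimplex p) =
      (TopCat.toSSet.obj (TopCat.of X)).δ 1 (pathSimplex p) := by
    apply (TopCat.toSSetObjEquiv (TopCat.of X) _).injective
    ext z
    obtain rfl := Subsingleton.elim z (stdSimplex.vertex 0)
    refine (TopCat.toSSetObjEquiv_δ_apply (X := TopCat.of X) (n := 0) _ 0 _).trans
      (Eq.trans ?_ (TopCat.toSSetObjEquiv_δ_apply (X := TopCat.of X) (n := 0) _ 1 _).symm)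
    rw [stdSimplex.map_vertex, stdSimplex.map_vertex]
    exact p.target.trans p.source.symm
  rw [SSet.ιChainComplex_d]
  simp [Fin.sum_univ_two, h]

/-- The homology class in `H₁(X, ℤ)` of a loop. -/
def loopClass {X : Type} [TopologicalSpace X] {x : X} (p : Path x x) : H1 X :=
  (HomologicalComplex.liftCycles
      ((TopCat.toSSet.obj (TopCat.of X)).chainComplex (ModuleCat.of ℤ ℤ))
      (SSet.ιChainComplex (R := ModuleCat.of ℤ ℤ) _ (pathSimplex p)) 0 (by simp)
      (pathSimplex_boundary p) ≫
    HomologicalComplex.homologyπ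
      ((TopCat.toSSet.obj (TopCat.of X)).chainComplex (ModuleCat.of ℤ ℤ)) 1).hom (1 : ℤ)

/-! ### The modular curve `X₀(N)` -/

/-- The extended upper half-plane `ℍ ∪ ℙ¹(ℚ)`. -/
inductive ExtendedUpperHalfPlane where
  | ofPoint (z : ℍ) : ExtendedUpperHalfPlane
  | ofCusp (s : OnePoint ℚ) : ExtendedUpperHalfPlane

namespace ExtendedUpperHalfPlane

/-- `GL₂(ℚ)` acts on `ℍ ∪ ℙ¹(ℚ)` by Möbius transformations. A matrix of negative determinant
acts on `ℍ` by `z ↦ (a * conj z + b) / (c * conj z + d)`. -/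
instance : MulAction (GL (Fin 2) ℚ) ExtendedUpperHalfPlane where
  smul g x := match x with
    | ofPoint z => ofPoint (g.map (algebraMap ℚ ℝ) • z)
    | ofCusp s => ofCusp (g • s)
  one_smul x := by
    cases x with
    | ofPoint z => exact congrArg ofPoint (by rw [map_one, one_smul])
    | ofCusp s => exact congrArg ofCusp (one_smul _ s)
  mul_smul g h x := by
    cases x with
    | ofPoint z => exact congrArg ofPoint (by rw [map_mul, mul_smul])
    | ofCusp s => exact congrArg ofCusp (mul_smul g h s)

theorem smul_ofPoint (g : GL (Fin 2) ℚ) (z : ℍ) :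
    g • ofPoint z = ofPoint (g.map (algebraMap ℚ ℝ) • z) := rfl

theorem smul_ofCusp (g : GL (Fin 2) ℚ) (s : OnePoint ℚ) : g • ofCusp s = ofCusp (g • s) := rfl

/-- The usual (horoball) topology: a set is open if it meets `ℍ` in an open set and contains,
with each cusp `g ∞`, some horoball `g {z | Y < im z}` at this cusp. -/
instance : TopologicalSpace ExtendedUpperHalfPlane where
  IsOpen U := IsOpen {z : ℍ | ofPoint z ∈ U} ∧
    ∀ g : GL (Fin 2) ℚ, g • ofCusp OnePoint.infty ∈ U →
      ∃ Y : ℝ, ∀ z : ℍ, Y < z.im → g • ofPoint z ∈ U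
  isOpen_univ := ⟨isOpen_univ, fun _ _ => ⟨0, fun _ _ => trivial⟩⟩
  isOpen_inter U V hU hV := by
    refine ⟨hU.1.inter hV.1, fun g hg => ?_⟩
    obtain ⟨Y₁, h₁⟩ := hU.2 g hg.1
    obtain ⟨Y₂, h₂⟩ := hV.2 g hg.2
    exact ⟨max Y₁ Y₂, fun z hz => ⟨h₁ z (lt_of_le_of_lt (le_max_left _ _) hz),
      h₂ z (lt_of_le_of_lt (le_max_right _ _) hz)⟩⟩
  isOpen_sUnion S hS := by
    refine ⟨?_, ?_⟩
    · have : {z : ℍ | ofPoint z ∈ ⋃₀ S} = ⋃ U ∈ S, {z : ℍ | ofPoint z ∈ U} := by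
        ext z; simp
      rw [this]
      exact isOpen_biUnion fun U hU => (hS U hU).1
    · rintro g ⟨U, hU, hg⟩
      obtain ⟨Y, hY⟩ := (hS U hU).2 g hg
      exact ⟨Y, fun z hz => ⟨U, hU, hY z hz⟩⟩

theorem isOpen_iff (U : Set ExtendedUpperHalfPlane) :
    IsOpen U ↔ IsOpen {z : ℍ | ofPoint z ∈ U} ∧
      ∀ g : GL (Fin 2) ℚ, g • ofCusp OnePoint.infty ∈ U →
        ∃ Y : ℝ, ∀ z : ℍ, Y < z.im → g • ofPoint z ∈ U := Iff.rfl

theorem continuous_ofPoint : Continuous ofPoint :=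
  ⟨fun _ hU => ((isOpen_iff _).1 hU).1⟩

instance : ContinuousConstSMul (GL (Fin 2) ℚ) ExtendedUpperHalfPlane where
  continuous_const_smul h := by
    refine ⟨fun U hU => ?_⟩
    rw [isOpen_iff] at hU ⊢
    refine ⟨?_, fun g hg => ?_⟩
    · exact hU.1.preimage (continuous_const_smul (h.map (algebraMap ℚ ℝ)))
    · have hg' : (h * g) • ofCusp OnePoint.infty ∈ U := by rw [mul_smul]; exact hg
      obtain ⟨Y, hY⟩ := hU.2 (h * g) hg'
      refine ⟨Y, fun z hz => ?_⟩
      have := hY z hz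
      rw [mul_smul] at this
      exact this

end ExtendedUpperHalfPlane

open ExtendedUpperHalfPlane

/-- `Γ₀(N)` as a subgroup of `GL₂(ℚ)`. -/
def Gamma0Q (N : ℕ) : Subgroup (GL (Fin 2) ℚ) :=
  (CongruenceSubgroup.Gamma0 N).map (Matrix.SpecialLinearGroup.mapGL ℚ)

/-- The (compact) modular curve `X₀(N) = Γ₀(N) \ (ℍ ∪ ℙ¹(ℚ))`, with the quotient topology. -/
def X0 (N : ℕ) : Type := MulAction.orbitRel.Quotient (Gamma0Q N) ExtendedUpperHalfPlane

instance (N : ℕ) : TopologicalSpace (X0 N) :=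
  inferInstanceAs (TopologicalSpace
    (Quotient (MulAction.orbitRel (Gamma0Q N) ExtendedUpperHalfPlane)))

namespace X0

/-- The projection `ℍ ∪ ℙ¹(ℚ) → X₀(N)`. -/
def mk (N : ℕ) (x : ExtendedUpperHalfPlane) : X0 N :=
  Quotient.mk (MulAction.orbitRel (Gamma0Q N) ExtendedUpperHalfPlane) x

theorem continuous_mk (N : ℕ) : Continuous (mk N) := continuous_quotient_mk'

theorem mk_smul (N : ℕ) (g : GL (Fin 2) ℚ) (hg : g ∈ Gamma0Q N) (x : ExtendedUpperHalfPlane) :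
    mk N (g • x) = mk N x :=
  Quotient.sound (s := MulAction.orbitRel (Gamma0Q N) ExtendedUpperHalfPlane) ⟨⟨g, hg⟩, rfl⟩

/-- The image in `X₀(N)` of a point of `ℍ`. -/
def ofPoint (N : ℕ) (z : ℍ) : X0 N := mk N (.ofPoint z)

theorem continuous_ofPoint (N : ℕ) : Continuous (ofPoint N) :=
  (continuous_mk N).comp ExtendedUpperHalfPlane.continuous_ofPoint

theorem ofPoint_smul (N : ℕ) (M : CongruenceSubgroup.Gamma0 N) (z : ℍ) :
    ofPoint N ((M : SL(2, ℤ)) • z) = ofPoint N z :=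
  mk_smul N (Matrix.SpecialLinearGroup.mapGL ℚ (M : SL(2, ℤ)))
    (Subgroup.mem_map_of_mem _ M.2) (.ofPoint z)

/-- The self-map of `X₀(N)` induced by the action on `ℍ ∪ ℙ¹(ℚ)` of a matrix `g` with
`g Γ₀(N) g⁻¹ ⊆ Γ₀(N)`. -/
def mapOfNormalizes (N : ℕ) (g : GL (Fin 2) ℚ)
    (hg : ∀ h ∈ Gamma0Q N, g * h * g⁻¹ ∈ Gamma0Q N) : C(X0 N, X0 N) where
  toFun := Quotient.lift (s := MulAction.orbitRel (Gamma0Q N) ExtendedUpperHalfPlane)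
    (fun x => mk N (g • x)) (by
      rintro x y ⟨⟨h, hh⟩, rfl⟩
      have := mk_smul N _ (hg h hh) (g • y)
      rw [← mul_smul, inv_mul_cancel_right, mul_smul] at this
      exact this)
  continuous_toFun := Continuous.quotient_lift
    ((continuous_mk N).comp (continuous_const_smul g)) _

/-- The matrix `diag(-1, 1)`, which acts on `ℍ` by `z ↦ -conj z`. -/
def conjMatrix : GL (Fin 2) ℚ := .mkOfDetNeZero !![-1, 0; 0, 1] (by simp)

/-- The matrix of the Atkin-Lehner involution, which acts on `ℍ` by `z ↦ -1 / (N z)`. -/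
def atkinLehnerMatrix (N : ℕ) [NeZero N] : GL (Fin 2) ℚ :=
  .mkOfDetNeZero !![0, -1; (N : ℚ), 0] (by simp [NeZero.ne N])

theorem mapGL_apply (M : SL(2, ℤ)) (i j : Fin 2) :
    (Matrix.SpecialLinearGroup.mapGL ℚ M).val i j = ((M.val i j : ℤ) : ℚ) := rfl

theorem conjMatrix_normalizes (N : ℕ) :
    ∀ h ∈ Gamma0Q N, conjMatrix * h * conjMatrix⁻¹ ∈ Gamma0Q N := by
  rintro _ ⟨M, hM, rfl⟩
  have hdet := M.det_coe
  rw [Matrix.det_fin_two] at hdet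
  obtain ⟨M', hM'⟩ : ∃ M' : SL(2, ℤ), M'.val = !![M 0 0, -M 0 1; -M 1 0, M 1 1] :=
    ⟨⟨_, by rw [Matrix.det_fin_two_of]; linear_combination hdet⟩, rfl⟩
  refine ⟨M', ?_, ?_⟩
  · have h : ((M 1 0 : ℤ) : ZMod N) = 0 := CongruenceSubgroup.Gamma0_mem.1 hM
    refine CongruenceSubgroup.Gamma0_mem.2 ?_
    simp [hM', h]
  · rw [eq_mul_inv_iff_mul_eq]
    ext i j
    fin_cases i <;> fin_cases j <;>
      simp [conjMatrix, Matrix.mul_apply, Fin.sum_univ_two, mapGL_apply, hM',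
        -Matrix.SpecialLinearGroup.mapGL_coe_matrix]

theorem atkinLehnerMatrix_normalizes (N : ℕ) [NeZero N] :
    ∀ h ∈ Gamma0Q N, atkinLehnerMatrix N * h * (atkinLehnerMatrix N)⁻¹ ∈ Gamma0Q N := by
  rintro _ ⟨M, hM, rfl⟩
  have hdet := M.det_coe
  rw [Matrix.det_fin_two] at hdet
  obtain ⟨k, hk⟩ := (ZMod.intCast_zmod_eq_zero_iff_dvd _ N).1 (CongruenceSubgroup.Gamma0_mem.1 hM)
  obtain ⟨M', hM'⟩ : ∃ M' : SL(2, ℤ), M'.val = !![M 1 1, -k; -N * M 0 1, M 0 0] :=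
    ⟨⟨_, by rw [Matrix.det_fin_two_of]; linear_combination hdet + M 0 1 * hk⟩, rfl⟩
  refine ⟨M', CongruenceSubgroup.Gamma0_mem.2 (by simp [hM']), ?_⟩
  · have hk' : ((M 1 0 : ℤ) : ℚ) = N * k := by rw [hk]; push_cast; ring
    rw [eq_mul_inv_iff_mul_eq]
    ext i j
    fin_cases i <;> fin_cases j <;>
      simp [atkinLehnerMatrix, Matrix.mul_apply, Fin.sum_univ_two, hk', mul_comm,
        mapGL_apply, hM', -Matrix.SpecialLinearGroup.mapGL_coe_matrix]

/-- The complex conjugation `c` of the modular curve `X₀(N)`, induced by `z ↦ -conj z`. -/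
def complexConj (N : ℕ) : C(X0 N, X0 N) := mapOfNormalizes N conjMatrix (conjMatrix_normalizes N)

/-- The Atkin-Lehner involution `W_N` of `X₀(N)`, induced by `z ↦ -1 / (N z)`. -/
def atkinLehner (N : ℕ) [NeZero N] : C(X0 N, X0 N) :=
  mapOfNormalizes N (atkinLehnerMatrix N) (atkinLehnerMatrix_normalizes N)

/-- For `M ∈ Γ₀(N)` and a path `p` in `ℍ` from `z` to `M z`, the homology class of the loop
in `X₀(N)` that is the image of `p`. -/
def pathClass (N : ℕ) (M : CongruenceSubgroup.Gamma0 N) (z : ℍ)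
    (p : Path z ((M : SL(2, ℤ)) • z)) : H1 (X0 N) :=
  loopClass ((p.map (continuous_ofPoint N)).cast rfl (ofPoint_smul N M z).symm)

end X0

/-! ### The narrow class group -/

/-- The totally positive elements of `Kˣ`. -/
def totallyPositive (K : Type*) [Field K] : Subgroup Kˣ where
  carrier := {x | ∀ φ : K →+* ℝ, 0 < φ x}
  one_mem' φ := by simp
  mul_mem' hx hy φ := by simpa using mul_pos (hx φ) (hy φ)
  inv_mem' hx φ := by simpa using hx φ

/-- The narrow class group of a number field: fractional ideals modulo the principal ideals
generated by totally positive elements. -/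
def NarrowClassGroup (K : Type*) [Field K] [NumberField K] : Type _ :=
  (FractionalIdeal (𝓞 K)⁰ K)ˣ ⧸ (totallyPositive K).map (toPrincipalIdeal (𝓞 K) K)

namespace NarrowClassGroup

variable (K : Type*) [Field K] [NumberField K]

instance : CommGroup (NarrowClassGroup K) :=
  inferInstanceAs (CommGroup
    ((FractionalIdeal (𝓞 K)⁰ K)ˣ ⧸ (totallyPositive K).map (toPrincipalIdeal (𝓞 K) K)))

/-- The narrow class of a fractional ideal. -/
def mk : (FractionalIdeal (𝓞 K)⁰ K)ˣ →* NarrowClassGroup K :=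
  QuotientGroup.mk' ((totallyPositive K).map (toPrincipalIdeal (𝓞 K) K))

/-- The narrow class of a nonzero prime ideal. -/
def ofPrime (P : IsDedekindDomain.HeightOneSpectrum (𝓞 K)) : NarrowClassGroup K :=
  mk K (FractionalIdeal.mk0 K ⟨P.asIdeal, mem_nonZeroDivisors_of_ne_zero P.ne_bot⟩)

instance : Finite (NarrowClassGroup K) := by
  have hφ : Finite (K →+* ℝ) := by
    refine Finite.of_injective (fun φ : K →+* ℝ => Complex.ofRealHom.comp φ) fun φ ψ h => ?_
    ext x
    exact Complex.ofReal_injective (RingHom.congr_fun h x)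
  have h₁ : (totallyPositive K).FiniteIndex := by
    have : totallyPositive K =
        ⨅ φ : K →+* ℝ, (Units.posSubgroup ℝ).comap (Units.map (φ : K →* ℝ)) := by
      ext x
      rw [Subgroup.mem_iInf]
      rfl
    rw [this]
    refine Subgroup.finiteIndex_iInf fun φ => ⟨fun h => ?_⟩
    have h2 := (Units.posSubgroup ℝ).relIndex_dvd_index_of_normal
      (Units.map (φ : K →* ℝ)).range
    rw [← Subgroup.index_comap, h, Units.index_posSubgroup] at h2
    simp at h2
  have h₂ : (toPrincipalIdeal (𝓞 K) K).range.index ≠ 0 := by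
    have : Finite ((FractionalIdeal (𝓞 K)⁰ K)ˣ ⧸ (toPrincipalIdeal (𝓞 K) K).range) :=
      Finite.of_equiv _ (ClassGroup.equiv (R := 𝓞 K) K).toEquiv
    exact Subgroup.index_ne_zero_of_finite
  have h₃ : ((totallyPositive K).map (toPrincipalIdeal (𝓞 K) K)).FiniteIndex := by
    refine ⟨?_⟩
    rw [Subgroup.index_map]
    exact mul_ne_zero (fun h => h₁.index_ne_zero
      (Nat.eq_zero_of_zero_dvd (h ▸ Subgroup.index_dvd_of_le le_sup_left))) h₂
  exact Subgroup.finite_quotient_of_finiteIndex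

instance : Fintype (NarrowClassGroup K) := Fintype.ofFinite _

end NarrowClassGroup

/-! ### Heegner cycles -/

section Heegner

variable {K : Type*} [Field K] [NumberField K]

/-- With `s = √D`, the fractional ideal `(A, (-B + √D) / 2)`. -/
def quadIdeal (s : K) (A B : ℤ) : FractionalIdeal (𝓞 K)⁰ K :=
  FractionalIdeal.spanSingleton (𝓞 K)⁰ (A : K) +
    FractionalIdeal.spanSingleton (𝓞 K)⁰ ((-(B : K) + s) / 2)

/-- `γ` is the homology class in `X₀(N)` attached to the narrow ideal class `c`:
for some representative `I = (A, (-B + √D) / 2)` of `c` with `A > 0`, `N` exactly dividing `A`,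
`B ≡ δ` modulo `N` and `B² - 4AC = D`, and with the unit `ε` written as `u + v √D`,
the matrix `M` with rows `(u - Bv, -2Cv)` and `(2Av, u + Bv)` lies in `Γ₀(N)`, and `γ` is the
homology class of the image of a path in `ℍ` from some point `z` to `M z`. -/
def IsHeegnerCycle (N : ℕ) (s : K) (ε : (𝓞 K)ˣ) (δ : ℤ) (c : NarrowClassGroup K)
    (γ : H1 (X0 N)) : Prop :=
  ∃ (A B C : ℤ) (I : (FractionalIdeal (𝓞 K)⁰ K)ˣ) (u v : ℚ) (M : CongruenceSubgroup.Gamma0 N)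
    (z : ℍ) (p : Path z ((M : SL(2, ℤ)) • z)),
    0 < A ∧ (N : ℤ) ∣ A ∧ ¬ (N : ℤ) ^ 2 ∣ A ∧ B ≡ δ [ZMOD N] ∧
    B ^ 2 - 4 * A * C = NumberField.discr K ∧
    (I : FractionalIdeal (𝓞 K)⁰ K) = quadIdeal s A B ∧ NarrowClassGroup.mk K I = c ∧
    ((ε : 𝓞 K) : K) = (u : K) + (v : K) * s ∧
    (M : SL(2, ℤ)).val.map (Int.cast : ℤ → ℚ) =
      !![u - B * v, -2 * C * v; 2 * A * v, u + B * v] ∧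
    γ = X0.pathClass N M z p

/-- The Heegner cycle `γ_c ∈ H₁(X₀(N), ℤ)` of a narrow ideal class `c`. -/
def heegnerCycle (N : ℕ) (s : K) (ε : (𝓞 K)ˣ) (δ : ℤ) (c : NarrowClassGroup K) : H1 (X0 N) :=
  Classical.epsilon (IsHeegnerCycle N s ε δ c)

/-- `[χ] = ∑ χ⁻¹(c) γ_c ∈ ℂ ⊗ H₁(X₀(N), ℤ)`, the sum being over the narrow class group. -/
def heegnerSum (N : ℕ) (s : K) (ε : (𝓞 K)ˣ) (δ : ℤ) (χ : NarrowClassGroup K →* ℂˣ) :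
    ℂ ⊗[ℤ] H1 (X0 N) :=
  ∑ c, ((χ c)⁻¹ : ℂˣ).val ⊗ₜ[ℤ] heegnerCycle N s ε δ c

end Heegner

/-- Complex conjugation of the coefficients of `ℂ ⊗ H₁(X, ℤ)`. -/
def conjCoeff (X : Type) [TopologicalSpace X] : ℂ ⊗[ℤ] H1 X →ₗ[ℤ] ℂ ⊗[ℤ] H1 X :=
  LinearMap.rTensor (H1 X) (starRingEnd ℂ).toAddMonoidHom.toIntLinearMap

/-- The `ℂ`-linear extension to `ℂ ⊗ H₁` of the map induced on `H₁` by a continuous map. -/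
def H1.mapComplex {X Y : Type} [TopologicalSpace X] [TopologicalSpace Y] (f : C(X, Y)) :
    ℂ ⊗[ℤ] H1 X →ₗ[ℂ] ℂ ⊗[ℤ] H1 Y :=
  (H1.map f).toIntLinearMap.baseChange ℂ

end

/-! The class of the image of a path from `z` to `Mz` defines a homomorphism `X0.cycle` from Γ₀(N)
to H₁(X₀(N), ℤ): ℍ is simply connected and Γ₀(N) acts trivially on the images of paths. Since H₁ is
abelian, it is constant on conjugacy classes.

Put β = (-B + √D)/2. The matrix M_I is that of multiplication by ε in the basis (β, A) of I. Two
representatives of one narrow class therefore have matrices conjugate in SL₂(ℤ), and the congruence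
B ≡ B' ≡ δ forces the conjugating matrix into Γ₀(N) (`cycle_eq_of_mk_eq`). Representatives exist
because the values of a form can be prescribed modulo N and N² (`exists_heegner_rep`), and γ_I is
well defined.

For the symmetry, choose the representative (NA₁, B, C) with C > 0 prime to N. Conjugation by the
matrices of c and W_N takes M_I to the inverse of the matrix of the form (NC, B, A₁)
(`X0.map_atkinLehner_complexConj_cycle`). The ideals satisfy (NA₁, β)(NC, β) = β(N, β), where β has
norm NA₁C > 0, so the second form lies in the class 𝔑[I]⁻¹ (`mk_mul_mk`). Hence W_N c(γ_c) =
-γ_{𝔑c⁻¹} (`exists_isHeegnerCycle_pair`). As χ is unitary, reindexing the sum by c ↦ 𝔑c⁻¹ gives the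
identity. -/

open CategoryTheory

noncomputable section

/-! ### Paths in singular chains modulo boundaries -/

variable {X Y : Type} [TopologicalSpace X] [TopologicalSpace Y]

/-- The singular chain complex of a space, with integral coefficients. -/
abbrev singularChains (X : Type) [TopologicalSpace X] : ChainComplex (ModuleCat.{0} ℤ) ℕ :=
  (TopCat.toSSet.obj (TopCat.of X)).chainComplex (ModuleCat.of ℤ ℤ)

/-- The class of a path in `C₁ / ∂C₂`. -/
def pathOp {x y : X} (p : Path x y) : (singularChains X).opcycles 1 :=
  (SSet.ιChainComplex (R := ModuleCat.of ℤ ℤ) _ (pathSimplex p) ≫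
    (singularChains X).pOpcycles 1).hom (1 : ℤ)

/-- The inclusion of `H₁` into `C₁ / ∂C₂`. -/
def H1.toOp (X : Type) [TopologicalSpace X] : H1 X →+ (singularChains X).opcycles 1 :=
  ((singularChains X).homologyι 1).hom.toAddMonoidHom

theorem H1.toOp_injective : Function.Injective (H1.toOp X) :=
  (ModuleCat.mono_iff_injective ((singularChains X).homologyι 1)).1 inferInstance

theorem H1.toOp_loopClass {x : X} (p : Path x x) : H1.toOp X (loopClass p) = pathOp p := by
  have h : (HomologicalComplex.liftCycles (singularChains X)
      (SSet.ιChainComplex (R := ModuleCat.of ℤ ℤ) _ (pathSimplex p)) 0 (by simp)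
      (pathSimplex_boundary p) ≫ HomologicalComplex.homologyπ (singularChains X) 1) ≫
      (singularChains X).homologyι 1 =
      SSet.ιChainComplex (R := ModuleCat.of ℤ ℤ) _ (pathSimplex p) ≫
    (singularChains X).pOpcycles 1 := by
    simp
  exact congrArg (fun f => f.hom (1 : ℤ)) h

theorem pathSimplex_congr {x y x' y' : X} {p : Path x y} {q : Path x' y'} (h : ∀ t, p t = q t) :
    pathSimplex p = pathSimplex q := by
  unfold pathSimplex
  congr 2
  ext t
  exact h t

theorem pathOp_congr {x y x' y' : X} {p : Path x y} {q : Path x' y'} (h : ∀ t, p t = q t) :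
    pathOp p = pathOp q := by
  unfold pathOp
  rw [pathSimplex_congr h]

theorem pathSimplex_eq_δ (τ : C(stdSimplex ℝ (Fin 3), X)) {x y : X} (p : Path x y) (i : Fin 3)
    (h : ∀ z : stdSimplex ℝ (Fin 2),
      p (stdSimplexHomeomorphUnitInterval z) = τ (stdSimplex.map i.succAbove z)) :
    (TopCat.toSSet.obj (TopCat.of X)).δ i
      ((TopCat.toSSetObjEquiv (TopCat.of X) (Opposite.op (SimplexCategory.mk 2))).symm τ) =
      pathSimplex p := by
  apply (TopCat.toSSetObjEquiv (TopCat.of X) _).injective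
  ext z
  refine (TopCat.toSSetObjEquiv_δ_apply (X := TopCat.of X) (n := 1) _ i _).trans ?_
  rw [pathSimplex, Equiv.apply_symm_apply, Equiv.apply_symm_apply]
  exact (h z).symm

/-- The boundary of a triangle vanishes in `C₁ / ∂C₂`. -/
theorem pathOp_triangle (τ : C(stdSimplex ℝ (Fin 3), X)) {x y z x' y' z' : X} (p : Path x y)
    (q : Path y' z) (r : Path x' z')
    (hp : ∀ w : stdSimplex ℝ (Fin 2),
      p (stdSimplexHomeomorphUnitInterval w) = τ (stdSimplex.map (Fin.succAbove 2) w))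
    (hq : ∀ w : stdSimplex ℝ (Fin 2),
      q (stdSimplexHomeomorphUnitInterval w) = τ (stdSimplex.map (Fin.succAbove 0) w))
    (hr : ∀ w : stdSimplex ℝ (Fin 2),
      r (stdSimplexHomeomorphUnitInterval w) = τ (stdSimplex.map (Fin.succAbove 1) w)) :
    pathOp p + pathOp q = pathOp r := by
  have h := (singularChains X).d_pOpcycles 2 1
  have h2 := SSet.ιChainComplex_d (R := ModuleCat.of ℤ ℤ) (TopCat.toSSet.obj (TopCat.of X))
    ((TopCat.toSSetObjEquiv (TopCat.of X) (Opposite.op (SimplexCategory.mk 2))).symm τ)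
  rw [Fin.sum_univ_three, pathSimplex_eq_δ τ p 2 hp, pathSimplex_eq_δ τ q 0 hq,
    pathSimplex_eq_δ τ r 1 hr] at h2
  have h3 := congrArg (fun f => (f ≫ (singularChains X).pOpcycles 1).hom (1 : ℤ)) h2
  simp only [Category.assoc, h, Limits.comp_zero] at h3
  have h4 : 0 = pathOp q - pathOp r + pathOp p := by
    refine h3.trans ?_
    simp [pathOp, sub_eq_add_neg]
  rw [eq_comm, ← sub_eq_zero, ← neg_eq_zero, h4]
  abel

/-- The constant triangle gives a + a = a. -/
theorem pathOp_refl (x : X) : pathOp (Path.refl x) = 0 := by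
  have := pathOp_triangle (ContinuousMap.const _ x) (Path.refl x) (Path.refl x) (Path.refl x)
    (fun _ => rfl) (fun _ => rfl) (fun _ => rfl)
  simpa using this

theorem stdSimplex_map_succAbove_apply (z : stdSimplex ℝ (Fin 2)) (i : Fin 3) (j : Fin 3) :
    stdSimplex.map (Fin.succAbove i) z j = ∑ k, if i.succAbove k = j then z k else 0 := by
  rw [stdSimplex.map_coe, FunOnFinite.linearMap_apply_apply, Finset.sum_filter]

/-- The boundary of a triangle in the plane maps to zero in `C₁ / ∂C₂`. -/
theorem pathOp_triangle_plane {F : ℝ × ℝ → X} (hF : Continuous F) {x y z x' y' z' : X}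
    (p : Path x y) (q : Path y' z) (r : Path x' z') (hp : ∀ t, p t = F (t, 0))
    (hq : ∀ t, q t = F (1 - t, t)) (hr : ∀ t, r t = F (0, t)) :
    pathOp p + pathOp q = pathOp r := by
  have hc (w : stdSimplex ℝ (Fin 2)) : w 0 = 1 - w 1 := by
    have : w 0 + w 1 = 1 := by
      have := w.2.2
      rwa [Fin.sum_univ_two] at this
    linarith
  have h1 (w : stdSimplex ℝ (Fin 2)) : (stdSimplexHomeomorphUnitInterval w : ℝ) = w 1 := rfl
  refine pathOp_triangle ⟨fun τ => F (τ 1, τ 2), hF.comp ?_⟩ p q r ?_ ?_ ?_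
  · exact ((continuous_apply 1).comp continuous_subtype_val).prodMk
      ((continuous_apply 2).comp continuous_subtype_val)
  · intro w
    rw [hp, ContinuousMap.coe_mk, stdSimplex_map_succAbove_apply, stdSimplex_map_succAbove_apply,
      Fin.sum_univ_two, Fin.sum_univ_two, h1]
    simp only [show Fin.succAbove (2 : Fin 3) 0 = 0 from rfl,
      show Fin.succAbove (2 : Fin 3) 1 = 1 from rfl]
    simp
  · intro w
    rw [hq, ContinuousMap.coe_mk, stdSimplex_map_succAbove_apply, stdSimplex_map_succAbove_apply,
      Fin.sum_univ_two, Fin.sum_univ_two, h1]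
    simp only [show Fin.succAbove (0 : Fin 3) 0 = 1 from rfl,
      show Fin.succAbove (0 : Fin 3) 1 = 2 from rfl, hc]
    simp
  · intro w
    rw [hr, ContinuousMap.coe_mk, stdSimplex_map_succAbove_apply, stdSimplex_map_succAbove_apply,
      Fin.sum_univ_two, Fin.sum_univ_two, h1]
    simp only [show Fin.succAbove (1 : Fin 3) 0 = 0 from rfl,
      show Fin.succAbove (1 : Fin 3) 1 = 2 from rfl]
    simp

/-- The concatenation of paths is the sum modulo boundaries. -/
theorem pathOp_trans {x y z : X} (p : Path x y) (q : Path y z) :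
    pathOp (p.trans q) = pathOp p + pathOp q := by
  -- On the three edges v₁/2 + v₂ runs over [0, 1/2], [1/2, 1] and [0, 1], which gives `p`, `q` and
  -- the concatenation.
  refine (pathOp_triangle_plane (F := fun v => (p.trans q).extend (v.1 / 2 + v.2)) ?_ p q _
    ?_ ?_ ?_).symm
  · exact (p.trans q).continuous_extend.comp (by fun_prop)
  · intro t
    have ht := t.2
    have h : ((t : ℝ) / 2 + 0) ∈ unitInterval := ⟨by linarith [ht.1], by linarith [ht.2]⟩
    rw [Path.extend_apply _ h, Path.trans_apply, dif_pos (by simp; linarith [ht.2])]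
    congr 1
    ext
    simp; ring
  · intro t
    have ht := t.2
    have h : ((1 - t : ℝ) / 2 + t) ∈ unitInterval :=
      ⟨by linarith [ht.1, ht.2], by linarith [ht.2]⟩
    rw [Path.extend_apply _ h, Path.trans_apply]
    split_ifs with h'
    -- The two halves overlap only at the parameter 1/2, that is at t = 0.
    · simp only at h'
      have : t = 0 := Subtype.ext (le_antisymm (by simp; linarith) ht.1)
      subst this
      simp
    · congr 1
      ext
      simp; ring
  · intro t
    simp

/-- Homotopic paths agree modulo boundaries. -/
theorem pathOp_eq_of_homotopic {x y : X} {p q : Path x y} (h : p.Homotopic q) :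
    pathOp p = pathOp q := by
  obtain ⟨H⟩ := h
  set P : ℝ → unitInterval := Set.projIcc 0 1 zero_le_one with hP
  have hPc : Continuous P := continuous_projIcc
  have hP' (t : unitInterval) : P t = t := Set.projIcc_val zero_le_one t
  have hP0 : P 0 = 0 := hP' 0
  have hP1 : P 1 = 1 := hP' 1
  -- The diagonal cuts the square of the homotopy into two triangles; each has one constant edge.
  let d : Path x y :=
    { toFun := fun t => H (t, t)
      continuous_toFun := by fun_prop
      source' := by simp
      target' := by simp }
  have h1 : pathOp p + pathOp (Path.refl y) = pathOp d :=
    pathOp_triangle_plane (F := fun v => H (P v.2, P (v.1 + v.2))) (by fun_prop) _ _ _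
      (fun t => by simp [hP0, hP']) (fun t => by simp [hP1]) (fun t => by simp [hP', d])
  have h2 : pathOp (Path.refl x) + pathOp q = pathOp d :=
    pathOp_triangle_plane (F := fun v => H (P (v.1 + v.2), P v.2)) (by fun_prop) _ _ _
      (fun t => by simp [hP0]) (fun t => by simp [hP1, hP']) (fun t => by simp [hP', d])
  rw [pathOp_refl, add_zero] at h1
  rw [pathOp_refl, zero_add] at h2
  rw [h1, h2]

/-- Both sides are compared in C₁ / ∂C₂, where H₁ embeds and only naturality of chain maps is
needed. -/
theorem H1.map_loopClass {x : X} (f : C(X, Y)) (p : Path x x) :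
    H1.map f (loopClass p) = loopClass (p.map f.continuous) := by
  apply H1.toOp_injective
  rw [H1.toOp_loopClass]
  have hs : (TopCat.toSSet.map (TopCat.ofHom f)).app _ (pathSimplex p) =
      pathSimplex (p.map f.continuous) := rfl
  have h := @SSet.ι_chainComplexMap_f _ _ _ _ _ _
    (TopCat.toSSet.map (TopCat.ofHom f)) (ModuleCat.of ℤ ℤ) _ (pathSimplex p)
  rw [hs] at h
  have h3 : (HomologicalComplex.liftCycles (singularChains X)
      (SSet.ιChainComplex (R := ModuleCat.of ℤ ℤ) _ (pathSimplex p)) 0 (by simp)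
      (pathSimplex_boundary p) ≫ HomologicalComplex.homologyπ (singularChains X) 1) ≫
      HomologicalComplex.homologyMap (SSet.chainComplexMap
        (TopCat.toSSet.map (TopCat.ofHom f)) (ModuleCat.of ℤ ℤ)) 1 ≫
      (singularChains Y).homologyι 1 =
      SSet.ιChainComplex (R := ModuleCat.of ℤ ℤ) _ (pathSimplex (p.map f.continuous)) ≫
        (singularChains Y).pOpcycles 1 := by
    rw [HomologicalComplex.homologyι_naturality, ← h]
    simp
  exact congrArg (fun f => f.hom (1 : ℤ)) h3

/-! ### Paths in the upper half-plane -/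

namespace X0

variable (N : ℕ)

/-- The class in `C₁ / ∂C₂` of the image in `X₀(N)` of a path in `ℍ`. -/
def segOp (z w : ℍ) : (singularChains (X0 N)).opcycles 1 :=
  pathOp ((PathConnectedSpace.somePath z w).map (continuous_ofPoint N))

/-- All paths in ℍ with given endpoints are homotopic, so only the endpoints matter. -/
theorem pathOp_map_ofPoint {z w : ℍ} (p : Path z w) :
    pathOp (p.map (continuous_ofPoint N)) = segOp N z w :=
  pathOp_eq_of_homotopic ((SimplyConnectedSpace.paths_homotopic p _).map
    ⟨_, continuous_ofPoint N⟩)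

theorem segOp_add (z w y : ℍ) : segOp N z w + segOp N w y = segOp N z y := by
  rw [← pathOp_map_ofPoint N ((PathConnectedSpace.somePath z w).trans
    (PathConnectedSpace.somePath w y)), Path.map_trans, pathOp_trans]
  rfl

theorem continuous_sl_smul (M : SL(2, ℤ)) : Continuous fun z : ℍ => M • z :=
  continuous_const_smul (Matrix.SpecialLinearGroup.mapGL ℝ M)

theorem segOp_smul (M : CongruenceSubgroup.Gamma0 N) (z w : ℍ) :
    segOp N ((M : SL(2, ℤ)) • z) ((M : SL(2, ℤ)) • w) = segOp N z w := by
  rw [← pathOp_map_ofPoint N ((PathConnectedSpace.somePath z w).map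
    (continuous_sl_smul (M : SL(2, ℤ))))]
  exact pathOp_congr fun t => ofPoint_smul N M _

theorem toOp_pathClass (M : CongruenceSubgroup.Gamma0 N) (z : ℍ)
    (p : Path z ((M : SL(2, ℤ)) • z)) :
    H1.toOp _ (pathClass N M z p) = segOp N z ((M : SL(2, ℤ)) • z) := by
  rw [pathClass, H1.toOp_loopClass, ← pathOp_map_ofPoint N p]
  exact pathOp_congr fun t => rfl

/-- The homology class of the image in `X₀(N)` of a path in `ℍ` from `z` to `M z`. -/
def cycle (M : CongruenceSubgroup.Gamma0 N) : H1 (X0 N) :=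
  pathClass N M UpperHalfPlane.I (PathConnectedSpace.somePath _ _)

/-- The two ways from z to Mw, through w and through Mz, agree; the sides zw and (Mz)(Mw) have the
same image in X₀(N) and cancel. -/
theorem pathClass_eq_cycle (M : CongruenceSubgroup.Gamma0 N) (z : ℍ)
    (p : Path z ((M : SL(2, ℤ)) • z)) : pathClass N M z p = cycle N M := by
  apply H1.toOp_injective
  rw [cycle, toOp_pathClass, toOp_pathClass]
  generalize UpperHalfPlane.I = w
  have h := segOp_add N z w ((M : SL(2, ℤ)) • w)
  rw [← segOp_add N z ((M : SL(2, ℤ)) • z) ((M : SL(2, ℤ)) • w), segOp_smul, add_comm] at h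
  exact (add_right_cancel h).symm

theorem toOp_cycle (M : CongruenceSubgroup.Gamma0 N) (z : ℍ) :
    H1.toOp _ (cycle N M) = segOp N z ((M : SL(2, ℤ)) • z) := by
  rw [← toOp_pathClass N M z (PathConnectedSpace.somePath _ _), pathClass_eq_cycle]

/-- The path from i to MM'i is cut at M'i, which serves as base point for M. -/
theorem cycle_mul (M M' : CongruenceSubgroup.Gamma0 N) :
    cycle N (M * M') = cycle N M + cycle N M' := by
  apply H1.toOp_injective
  rw [map_add, toOp_cycle N (M * M') UpperHalfPlane.I, toOp_cycle N M' UpperHalfPlane.I,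
    toOp_cycle N M ((M' : SL(2, ℤ)) • UpperHalfPlane.I), add_comm, segOp_add, Subgroup.coe_mul, mul_smul]

theorem cycle_one : cycle N 1 = 0 := by
  have := cycle_mul N 1 1
  simpa using this

theorem cycle_inv (M : CongruenceSubgroup.Gamma0 N) : cycle N M⁻¹ = - cycle N M := by
  rw [eq_neg_iff_add_eq_zero, ← cycle_mul, inv_mul_cancel, cycle_one]

theorem cycle_conj (g M : CongruenceSubgroup.Gamma0 N) :
    cycle N (g * M * g⁻¹) = cycle N M := by
  rw [cycle_mul, cycle_mul, cycle_inv]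
  abel

/-- The map g carries a path from i to Mi to one from gi to gMi = M'gi. Only its continuity on ℍ
matters, so negative determinants are allowed. -/
theorem map_mapOfNormalizes_cycle (g : GL (Fin 2) ℚ)
    (hg : ∀ h ∈ Gamma0Q N, g * h * g⁻¹ ∈ Gamma0Q N) (M M' : CongruenceSubgroup.Gamma0 N)
    (h : g * Matrix.SpecialLinearGroup.mapGL ℚ (M : SL(2, ℤ)) =
      Matrix.SpecialLinearGroup.mapGL ℚ (M' : SL(2, ℤ)) * g) :
    H1.map (mapOfNormalizes N g hg) (cycle N M) = cycle N M' := by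
  have hm (M : SL(2, ℤ)) (z : ℍ) : M • z = Matrix.GeneralLinearGroup.map (algebraMap ℚ ℝ)
      (Matrix.SpecialLinearGroup.mapGL ℚ M) • z := by
    change Matrix.SpecialLinearGroup.mapGL ℝ M • z = _
    congr 1
    ext i j
    simp
  have key (z : ℍ) : (g.map (algebraMap ℚ ℝ)) • ((M : SL(2, ℤ)) • z) =
      (M' : SL(2, ℤ)) • ((g.map (algebraMap ℚ ℝ)) • z) := by
    have h2 := congrArg (Matrix.GeneralLinearGroup.map (algebraMap ℚ ℝ)) h
    rw [map_mul, map_mul] at h2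
    have h3 := congrArg (fun k => k • z) h2
    simpa only [mul_smul, ← hm] using h3
  rw [cycle, pathClass, H1.map_loopClass]
  have := pathClass_eq_cycle N M' _ (((PathConnectedSpace.somePath UpperHalfPlane.I
    ((M : SL(2, ℤ)) • UpperHalfPlane.I)).map
      (continuous_const_smul (g.map (algebraMap ℚ ℝ)))).cast rfl (key _).symm)
  rw [← this, pathClass]
  apply H1.toOp_injective
  rw [H1.toOp_loopClass, H1.toOp_loopClass]
  exact pathOp_congr fun t => rfl
end X0

/-! ### Quadratic fields -/

section Quadratic

variable {K : Type*} [Field K] [NumberField K]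

/-- The vector 1 is primitive: the square of the gcd of its coordinates divides the norm of 1. A
Bézout relation completes it to a basis. -/
theorem exists_basis_zero_eq_one (hK : Module.finrank ℚ K = 2) :
    ∃ c : Module.Basis (Fin 2) ℤ (𝓞 K), c 0 = 1 := by
  have hr : Module.finrank ℤ (𝓞 K) = 2 := by rw [NumberField.RingOfIntegers.rank, hK]
  let e : Module.Basis (Fin 2) ℤ (𝓞 K) := Module.finBasisOfFinrankEq ℤ (𝓞 K) hr
  set a := e.repr 1 0 with ha
  set b := e.repr 1 1 with hb
  have h1 : (1 : 𝓞 K) = a • e 0 + b • e 1 := by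
    have := e.sum_repr 1
    rw [Fin.sum_univ_two] at this
    exact this.symm
  have hg : IsCoprime a b := by
    rw [Int.isCoprime_iff_gcd_eq_one]
    obtain ⟨a', ha'⟩ := Int.gcd_dvd_left a b
    obtain ⟨b', hb'⟩ := Int.gcd_dvd_right a b
    have h2 : (1 : 𝓞 K) = algebraMap ℤ (𝓞 K) (a.gcd b) * (a' • e 0 + b' • e 1) := by
      have ha2 : (a : 𝓞 K) = ((a.gcd b : ℕ) : 𝓞 K) * a' := by rw [← Int.cast_natCast, ← Int.cast_mul, ← ha']
      have hb2 : (b : 𝓞 K) = ((a.gcd b : ℕ) : 𝓞 K) * b' := by rw [← Int.cast_natCast, ← Int.cast_mul, ← hb']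
      simp only [zsmul_eq_mul] at h1
      simp only [zsmul_eq_mul, eq_intCast]
      push_cast
      linear_combination h1 + ha2 * e 0 + hb2 * e 1
    have h3 := congrArg (Algebra.norm ℤ) h2
    rw [map_one, map_mul, Algebra.norm_algebraMap, hr] at h3
    have h4 : IsUnit (a.gcd b : ℤ) :=
      isUnit_of_dvd_one ((dvd_pow_self _ two_ne_zero).trans (Dvd.intro _ h3.symm))
    simpa [Int.isUnit_iff_natAbs_eq] using h4
  obtain ⟨m, n, hmn⟩ := hg
  have hA : IsUnit (!![a, -n; b, m] : Matrix (Fin 2) (Fin 2) ℤ).det := by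
    rw [Matrix.det_fin_two_of]
    rw [show a * m - -n * b = 1 by linarith]
    exact isUnit_one
  refine ⟨e.map (Matrix.toLinearEquiv e _ hA), ?_⟩
  rw [Module.Basis.map_apply, Matrix.toLinearEquiv_apply, Matrix.toLin_self, Fin.sum_univ_two]
  simp [h1]

/-- If ω² = tω - n, the trace form in the basis 1, ω has determinant t² - 4n = (2ω - t)², hence √D =
±(2ω - t). -/
theorem exists_integral_basis (hK : Module.finrank ℚ K = 2) {s : K}
    (hs : s ^ 2 = (NumberField.discr K : K)) :
    ∃ (ω : 𝓞 K) (t n : ℤ), s = 2 * (ω : K) - t ∧ t ^ 2 - 4 * n = NumberField.discr K ∧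
      (∀ r : 𝓞 K, ∃ a b : ℤ, r = a + b * ω) ∧ ∀ q : ℚ, (q : K) ≠ s := by
  obtain ⟨c, hc⟩ := exists_basis_zero_eq_one hK
  set ω := c 1 with hω
  have hsum (r : 𝓞 K) : r = c.repr r 0 + c.repr r 1 * ω := by
    have := c.sum_repr r
    rw [Fin.sum_univ_two, hc] at this
    simpa using this.symm
  have hrepr (x y : ℤ) (i : Fin 2) : c.repr (x + y * ω : 𝓞 K) i = ![x, y] i := by
    have : (x + y * ω : 𝓞 K) = x • c 0 + y • c 1 := by
      simp only [hc, zsmul_eq_mul, mul_one, hω]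
    rw [this, map_add, map_smul, map_smul]
    fin_cases i <;> simp [-zsmul_eq_mul]
  set t := c.repr (ω ^ 2) 1 with ht
  set n := - c.repr (ω ^ 2) 0 with hn
  have hω2 : ω ^ 2 = t * ω - n := by
    have := hsum (ω ^ 2)
    rw [← ht, show c.repr (ω ^ 2) 0 = -n by simp [hn]] at this
    rw [this]; push_cast; ring
  have htr (x y : ℤ) : Algebra.trace ℤ (𝓞 K) (x + y * ω) = 2 * x + t * y := by
    rw [Algebra.trace_eq_matrix_trace c, Matrix.trace_fin_two, Algebra.leftMulMatrix_eq_repr_mul,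
      Algebra.leftMulMatrix_eq_repr_mul, hc, mul_one, ← hω,
      show (x + y * ω) * ω = ((-n * y : ℤ) : 𝓞 K) + ((x + t * y : ℤ) : 𝓞 K) * ω by
        push_cast; linear_combination (y : 𝓞 K) * hω2, hrepr, hrepr]
    simp; ring
  have hD : t ^ 2 - 4 * n = NumberField.discr K := by
    rw [← NumberField.discr_eq_discr K c, Algebra.discr_def, Matrix.det_fin_two]
    simp only [Algebra.traceMatrix_apply, Algebra.traceForm_apply, hc, ← hω]
    have h1 := htr 1 0
    have h2 := htr 0 1
    have h3 := htr (-n) t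
    have h4 : ω * ω = ((-n : ℤ) : 𝓞 K) + t * ω := by push_cast; linear_combination hω2
    rw [← h4] at h3
    simp at h1 h2
    simp [h1, h2, h3]
    ring
  have hq (q : ℚ) : (2 * (ω : K) - t) ≠ (q : K) := by
    intro h
    have hq0 : (q.den : K) ≠ 0 := by exact_mod_cast q.den_ne_zero
    have h2 : (((2 * q.den : ℤ) : 𝓞 K) * ω) = ((q.num + q.den * t : ℤ) : 𝓞 K) := by
      apply NumberField.RingOfIntegers.coe_injective
      simp only [map_mul, map_intCast]
      push_cast
      rw [Rat.cast_def, eq_div_iff hq0] at h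
      linear_combination h
    have h3 := congrArg (fun r => c.repr r 1) h2
    have h4 := hrepr 0 (2 * q.den) 1
    have h5 := hrepr (q.num + q.den * t) 0 1
    simp only [Int.cast_zero, zero_add, zero_mul, add_zero] at h4 h5
    simp only [h4, h5] at h3
    have := q.den_ne_zero
    simp at h3
  have hsω : (s - (2 * (ω : K) - t)) * (s + (2 * (ω : K) - t)) = 0 := by
    have h1 : (ω : K) ^ 2 = t * ω - n := by
      have := congrArg (algebraMap (𝓞 K) K) hω2
      simpa only [map_pow, map_sub, map_mul, map_intCast] using this
    have h2 : (t : K) ^ 2 - 4 * n = NumberField.discr K := by exact_mod_cast hD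
    linear_combination hs - 4 * h1 - h2
  rcases mul_eq_zero.1 hsω with h | h
  · refine ⟨ω, t, n, by linear_combination h, hD, fun r => ⟨_, _, hsum r⟩, fun q h' => hq q ?_⟩
    rw [h']; linear_combination -h
  -- The conjugate t - ω absorbs the sign.
  · refine ⟨t - ω, t, n, by
        rw [show ((t - ω : 𝓞 K) : K) = t - ω from
          (map_sub (algebraMap (𝓞 K) K) _ _).trans (by rw [map_intCast])]
        linear_combination h, hD,
      fun r => ⟨c.repr r 0 + t * c.repr r 1, - c.repr r 1, ?_⟩, fun q h' => hq (-q) ?_⟩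
    · push_cast
      linear_combination hsum r
    · push_cast
      rw [h']; linear_combination h

/-- The basis `1, s` of a quadratic field. -/
theorem exists_coords (hK : Module.finrank ℚ K = 2) {s : K} (hq : ∀ q : ℚ, (q : K) ≠ s) :
    ∃ B : Module.Basis (Fin 2) ℚ K, B 0 = 1 ∧ B 1 = s := by
  have hli : LinearIndependent ℚ ![1, s] := by
    rw [LinearIndependent.pair_iff' one_ne_zero]
    intro a h
    exact hq a (by simpa [Algebra.smul_def] using h)
  refine ⟨basisOfLinearIndependentOfCardEqFinrank hli (by simp [hK]), ?_, ?_⟩ <;> simp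

theorem eq_add_mul (hK : Module.finrank ℚ K = 2) {s : K} (hq : ∀ q : ℚ, (q : K) ≠ s) (x : K) :
    ∃ p q : ℚ, x = p + q * s := by
  obtain ⟨B, h0, h1⟩ := exists_coords hK hq
  refine ⟨B.repr x 0, B.repr x 1, ?_⟩
  have := B.sum_repr x
  rw [Fin.sum_univ_two, h0, h1] at this
  simpa [Algebra.smul_def] using this.symm

theorem add_mul_inj {s : K} (hq : ∀ q : ℚ, (q : K) ≠ s)
    {p q p' q' : ℚ} (h : (p + q * s : K) = p' + q' * s) : p = p' ∧ q = q' := by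
  have hqq : q = q' := by
    by_contra hne
    have h0 : ((q - q' : ℚ) : K) ≠ 0 := by exact_mod_cast sub_ne_zero.2 hne
    apply hq ((p' - p) / (q - q'))
    rw [Rat.cast_div, div_eq_iff h0]
    push_cast
    linear_combination -h
  subst hqq
  exact ⟨by exact_mod_cast add_right_cancel h, rfl⟩

theorem norm_add_mul (hK : Module.finrank ℚ K = 2) {s : K} (hq : ∀ q : ℚ, (q : K) ≠ s) {D : ℤ}
    (hs : s ^ 2 = (D : K)) (p q : ℚ) : Algebra.norm ℚ (p + q * s : K) = p ^ 2 - D * q ^ 2 := by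
  obtain ⟨B, h0, h1⟩ := exists_coords hK hq
  have hrepr (x y : ℚ) (i : Fin 2) : B.repr (x + y * s : K) i = ![x, y] i := by
    have : (x + y * s : K) = x • B 0 + y • B 1 := by
      simp [h0, h1, Algebra.smul_def]
    rw [this, map_add, map_smul, map_smul]
    fin_cases i <;> simp
  rw [Algebra.norm_eq_matrix_det B, Matrix.det_fin_two]
  simp only [Algebra.leftMulMatrix_eq_repr_mul, h0, h1, mul_one]
  rw [show (p + q * s) * s = ((q * D : ℚ) : K) + p * s by push_cast; linear_combination q * hs]
  simp only [hrepr]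
  simp
  ring

theorem norm_pos_of_totallyPositive [NumberField.IsTotallyReal K] {x : Kˣ}
    (hx : x ∈ totallyPositive K) : 0 < Algebra.norm ℚ (x : K) := by
  have h := Algebra.norm_eq_prod_embeddings ℚ ℂ (x : K)
  have hreal (φ : K →+* ℂ) : NumberField.ComplexEmbedding.IsReal φ := by
    have := NumberField.IsTotallyReal.isReal (NumberField.InfinitePlace.mk φ)
    exact NumberField.InfinitePlace.isReal_mk_iff.1 this
  have h2 (φ : K →ₐ[ℚ] ℂ) : φ x = (((hreal φ.toRingHom).embedding x : ℝ) : ℂ) :=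
    (NumberField.ComplexEmbedding.IsReal.coe_embedding_apply _ _).symm
  simp only [h2] at h
  rw [← Complex.ofReal_prod] at h
  have h3 : ((Algebra.norm ℚ (x : K) : ℚ) : ℝ) =
      ∏ φ : K →ₐ[ℚ] ℂ, (hreal φ.toRingHom).embedding x := by
    apply Complex.ofReal_injective
    rw [← h]
    simp
  have h4 : 0 < ((Algebra.norm ℚ (x : K) : ℚ) : ℝ) := by
    rw [h3]
    exact Finset.prod_pos fun φ _ => hx _
  exact_mod_cast h4

/-- Two real embeddings send s to equal or opposite values, so φ(x)ψ(x) is a square or the norm.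
Hence all φ(x) have the same sign. -/
theorem totallyPositive_or_neg {s : K} {D : ℤ} (hs : s ^ 2 = (D : K)) {x : Kˣ} {p q : ℚ}
    (hx : (x : K) = p + q * s) (h : 0 < p ^ 2 - D * q ^ 2) :
    x ∈ totallyPositive K ∨ -x ∈ totallyPositive K := by
  have hφ (φ : K →+* ℝ) : φ x = p + q * φ s := by simp [hx]
  have hφs (φ : K →+* ℝ) : φ s ^ 2 = D := by rw [← map_pow, hs]; simp
  have hR : (0 : ℝ) < p ^ 2 - D * q ^ 2 := by exact_mod_cast h
  have hpos (φ ψ : K →+* ℝ) : 0 < φ x * ψ x := by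
    have h0 : φ x ≠ 0 := by simp
    rcases sq_eq_sq_iff_eq_or_eq_neg.1 ((hφs φ).trans (hφs ψ).symm) with h' | h'
    · rw [hφ ψ, ← h', ← hφ]; exact mul_self_pos.2 h0
    · rw [hφ φ, hφ ψ, h']
      have := hφs ψ
      nlinarith
  by_cases hx : x ∈ totallyPositive K
  · exact .inl hx
  · right
    have : ¬ ∀ φ : K →+* ℝ, 0 < φ x := hx
    push Not at this
    obtain ⟨φ, hφ⟩ := this
    intro ψ
    have := hpos φ ψ
    rw [Units.val_neg, map_neg]
    nlinarith

end Quadratic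

/-! ### Ideals and binary quadratic forms -/

section Quadratic

variable {K : Type*} [Field K] [NumberField K]

/-- `K` is a quadratic field of discriminant `D` and `s = √D`; its ring of integers is spanned by
`1` and `(t + √D) / 2`. -/
structure IsQuadraticRoot (s : K) (D t n : ℤ) : Prop where
  finrank_eq : Module.finrank ℚ K = 2
  sq_eq : s ^ 2 = (D : K)
  ne_cast : ∀ q : ℚ, (q : K) ≠ s
  disc_eq : t ^ 2 - 4 * n = D
  mem_integers : ∃ ω : 𝓞 K, (ω : K) = (t + s) / 2
  exists_coords : ∀ r : 𝓞 K, ∃ a b : ℤ, (r : K) = a + b * ((t + s) / 2)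

theorem exists_isQuadraticRoot (hK : Module.finrank ℚ K = 2) {s : K}
    (hs : s ^ 2 = (NumberField.discr K : K)) :
    ∃ t n : ℤ, IsQuadraticRoot s (NumberField.discr K) t n := by
  obtain ⟨ω, t, n, h1, h2, h3, h4⟩ := exists_integral_basis hK hs
  have hω : (ω : K) = (t + s) / 2 := by rw [h1]; ring
  refine ⟨t, n, hK, hs, h4, h2, ⟨ω, hω⟩, fun r => ?_⟩
  obtain ⟨a, b, h⟩ := h3 r
  refine ⟨a, b, ?_⟩
  have := congrArg (algebraMap (𝓞 K) K) h
  simpa only [map_add, map_mul, map_intCast, hω] using this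

namespace IsQuadraticRoot

variable {s : K} {D t n : ℤ} (h : IsQuadraticRoot s D t n)
include h

theorem eq_add_mul (x : K) : ∃ p q : ℚ, x = p + q * s := _root_.eq_add_mul h.finrank_eq h.ne_cast x

theorem norm_eq (p q : ℚ) : Algebra.norm ℚ (p + q * s : K) = p ^ 2 - D * q ^ 2 :=
  norm_add_mul h.finrank_eq h.ne_cast h.sq_eq p q

theorem inj {p q p' q' : ℚ} (hp : (p + q * s : K) = p' + q' * s) : p = p' ∧ q = q' :=
  add_mul_inj h.ne_cast hp

theorem two_dvd {B : ℤ} (hB : 4 ∣ B ^ 2 - D) : 2 ∣ t + B := by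
  rw [← h.disc_eq] at hB
  have h2 : (2 : ℤ) ∣ B ^ 2 - t ^ 2 := by omega
  rcases Int.even_or_odd t with ht | ht <;> rcases Int.even_or_odd B with hb | hb
  · exact (ht.add hb).two_dvd
  · exfalso
    have : Odd (B ^ 2 - t ^ 2) := hb.pow.sub_even (ht.pow_of_ne_zero two_ne_zero)
    exact (Int.not_even_iff_odd.2 this) (even_iff_two_dvd.2 h2)
  · exfalso
    have : Odd (B ^ 2 - t ^ 2) := (hb.pow_of_ne_zero two_ne_zero).sub_odd ht.pow
    exact (Int.not_even_iff_odd.2 this) (even_iff_two_dvd.2 h2)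
  · exact (ht.add_odd hb).two_dvd

theorem exists_integer {B : ℤ} (hB : 2 ∣ t + B) : ∃ β : 𝓞 K, (β : K) = (-B + s) / 2 := by
  obtain ⟨k, hk⟩ := hB
  obtain ⟨ω, hω⟩ := h.mem_integers
  refine ⟨ω - (k : 𝓞 K), ?_⟩
  rw [show ((ω - (k : 𝓞 K) : 𝓞 K) : K) = ω - k from
    (map_sub (algebraMap (𝓞 K) K) _ _).trans (by rw [map_intCast]), hω]
  have : (t : K) + B = 2 * k := by exact_mod_cast hk
  linear_combination this / 2

theorem exists_coords' {B : ℤ} (hB : 2 ∣ t + B) (r : 𝓞 K) :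
    ∃ a b : ℤ, (r : K) = a + b * ((-B + s) / 2) := by
  obtain ⟨k, hk⟩ := hB
  obtain ⟨a, b, hr⟩ := h.exists_coords r
  refine ⟨a + b * k, b, ?_⟩
  have : (t : K) + B = 2 * k := by exact_mod_cast hk
  push_cast
  linear_combination hr + b * this / 2

theorem quad_sq {A B C : ℤ} (hf : B ^ 2 - 4 * A * C = D) :
    ((-B + s) / 2 : K) ^ 2 = -B * ((-B + s) / 2) - A * C := by
  have h1 : (B : K) ^ 2 - 4 * A * C = D := by exact_mod_cast hf
  linear_combination (h.sq_eq - h1) / 4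

/-- The lattice ℤA + ℤβ with β = (-B + s)/2 is already an ideal, because β² = -Bβ - AC. -/
theorem mem_quadIdeal {A B C : ℤ} (hf : B ^ 2 - 4 * A * C = D) {x : K} :
    x ∈ quadIdeal s A B ↔ ∃ k l : ℤ, x = k * A + l * ((-B + s) / 2) := by
  have hB : 2 ∣ t + B := h.two_dvd ⟨A * C, by linear_combination hf⟩
  obtain ⟨β, hβ⟩ := h.exists_integer hB
  have hsq := h.quad_sq hf
  rw [quadIdeal, FractionalIdeal.mem_add]
  constructor
  · rintro ⟨_, hi, _, hj, rfl⟩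
    obtain ⟨y, rfl⟩ := (FractionalIdeal.mem_spanSingleton _).1 hi
    obtain ⟨z, rfl⟩ := (FractionalIdeal.mem_spanSingleton _).1 hj
    obtain ⟨a, b, hy⟩ := h.exists_coords' hB y
    obtain ⟨c, d, hz⟩ := h.exists_coords' hB z
    refine ⟨a - d * C, b * A + c - d * B, ?_⟩
    rw [Algebra.smul_def, Algebra.smul_def, show algebraMap (𝓞 K) K y = _ from hy,
      show algebraMap (𝓞 K) K z = _ from hz]
    push_cast
    linear_combination d * hsq
  · rintro ⟨k, l, rfl⟩
    refine ⟨_, (FractionalIdeal.mem_spanSingleton _).2 ⟨(k : 𝓞 K), rfl⟩, _,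
      (FractionalIdeal.mem_spanSingleton _).2 ⟨(l : 𝓞 K), rfl⟩, ?_⟩
    simp [Algebra.smul_def]

omit h in
theorem quadIdeal_ne_zero (s : K) {A : ℤ} (B : ℤ) (hA : A ≠ 0) : quadIdeal s A B ≠ 0 := by
  intro h0
  have : (A : K) ∈ quadIdeal s A B := by
    rw [quadIdeal, FractionalIdeal.mem_add]
    exact ⟨_, FractionalIdeal.mem_spanSingleton_self _ _, 0, FractionalIdeal.zero_mem _, add_zero _⟩
  rw [h0, FractionalIdeal.mem_zero_iff] at this
  exact hA (by exact_mod_cast this)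

/-- An element of positive norm is totally positive up to sign, and the sign does not change the
ideal it generates. -/
theorem mk_eq_of_norm_pos {I I' : (FractionalIdeal (𝓞 K)⁰ K)ˣ} {x : K}
    (hx : 0 < Algebra.norm ℚ x)
    (hI : (I : FractionalIdeal (𝓞 K)⁰ K) = FractionalIdeal.spanSingleton (𝓞 K)⁰ x *
      (I' : FractionalIdeal (𝓞 K)⁰ K)) :
    NarrowClassGroup.mk K I = NarrowClassGroup.mk K I' := by
  have hx0 : x ≠ 0 := by
    rintro rfl
    simp [Algebra.norm_zero] at hx
  lift x to Kˣ using hx0.isUnit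
  have hneg : FractionalIdeal.spanSingleton (𝓞 K)⁰ (-(x : K)) =
      FractionalIdeal.spanSingleton (𝓞 K)⁰ (x : K) := by
    ext y
    rw [FractionalIdeal.mem_spanSingleton, FractionalIdeal.mem_spanSingleton]
    exact ⟨fun ⟨z, hz⟩ => ⟨-z, by simpa using hz⟩, fun ⟨z, hz⟩ => ⟨-z, by simpa using hz⟩⟩
  obtain ⟨y, hy, hyx⟩ : ∃ y ∈ totallyPositive K,
      FractionalIdeal.spanSingleton (𝓞 K)⁰ (y : K) = .spanSingleton (𝓞 K)⁰ (x : K) := by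
    obtain ⟨p, q, hpq⟩ := h.eq_add_mul (x : K)
    rw [hpq, h.norm_eq] at hx
    rcases totallyPositive_or_neg h.sq_eq hpq hx with hx | hx
    · exact ⟨_, hx, rfl⟩
    · exact ⟨_, hx, hneg⟩
  have hII : I = toPrincipalIdeal (𝓞 K) K y * I' := by
    ext1
    rw [hI, Units.val_mul, coe_toPrincipalIdeal, hyx]
  rw [hII, map_mul, mul_eq_right]
  exact (QuotientGroup.eq_one_iff _).2 (Subgroup.mem_map_of_mem _ hy)

omit h in
theorem exists_norm_pos_of_mk_eq [NumberField.IsTotallyReal K]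
    {I I' : (FractionalIdeal (𝓞 K)⁰ K)ˣ} (hI : NarrowClassGroup.mk K I = NarrowClassGroup.mk K I') :
    ∃ x : K, 0 < Algebra.norm ℚ x ∧
      (I : FractionalIdeal (𝓞 K)⁰ K) = FractionalIdeal.spanSingleton (𝓞 K)⁰ x *
        (I' : FractionalIdeal (𝓞 K)⁰ K) := by
  obtain ⟨y, hy, h⟩ := QuotientGroup.eq.1 hI.symm
  refine ⟨y, norm_pos_of_totallyPositive hy, ?_⟩
  rw [← coe_toPrincipalIdeal, ← Units.val_mul, h]
  simp

/-- The move `(A, B, C) ↦ (A x² + B x + C, -(B + 2 A x), A)` of binary quadratic forms preserves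
the narrow class. -/
theorem mk_eq_of_swap {A B C : ℤ} (hf : B ^ 2 - 4 * A * C = D) (x : ℤ) (hA : 0 < A)
    (hA' : 0 < A * x ^ 2 + B * x + C) {I I' : (FractionalIdeal (𝓞 K)⁰ K)ˣ}
    (hI : (I : FractionalIdeal (𝓞 K)⁰ K) = quadIdeal s A B)
    (hI' : (I' : FractionalIdeal (𝓞 K)⁰ K) =
      quadIdeal s (A * x ^ 2 + B * x + C) (-(B + 2 * A * x))) :
    NarrowClassGroup.mk K I = NarrowClassGroup.mk K I' := by
  have hA'K : ((A * x ^ 2 + B * x + C : ℤ) : K) ≠ 0 := by exact_mod_cast hA'.ne'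
  have hA'Q : ((A * x ^ 2 + B * x + C : ℤ) : ℚ) ≠ 0 := by exact_mod_cast hA'.ne'
  have hfK : (B : K) ^ 2 - 4 * A * C = D := by exact_mod_cast hf
  have hfQ : (B : ℚ) ^ 2 - 4 * A * C = D := by exact_mod_cast hf
  have hs := h.sq_eq
  -- With A' = Ax² + Bx + C, the multiplier is (β - Ax)/A', of norm A/A'. It sends the basis A', β'
  -- of the second ideal to β - Ax, -A.
  refine h.mk_eq_of_norm_pos (x := ((-(B + 2 * A * x) / 2 / (A * x ^ 2 + B * x + C : ℤ) : ℚ) : K) +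
    ((1 / 2 / (A * x ^ 2 + B * x + C : ℤ) : ℚ) : K) * s) ?_ ?_
  · rw [h.norm_eq]
    have : (-(B + 2 * A * x) / 2 / (A * x ^ 2 + B * x + C : ℤ) : ℚ) ^ 2 -
      D * (1 / 2 / (A * x ^ 2 + B * x + C : ℤ) : ℚ) ^ 2 = A / (A * x ^ 2 + B * x + C : ℤ) := by
      rw [← hfQ]
      field_simp
      push_cast
      ring
    rw [this]
    have h1 : (0 : ℚ) < A := by exact_mod_cast hA
    have h2 : (0 : ℚ) < (A * x ^ 2 + B * x + C : ℤ) := by exact_mod_cast hA'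
    positivity
  · rw [hI, hI']
    ext y
    rw [FractionalIdeal.mem_singleton_mul, h.mem_quadIdeal hf]
    simp only [h.mem_quadIdeal (A := A * x ^ 2 + B * x + C) (B := -(B + 2 * A * x)) (C := A)
      (by linear_combination hf)]
    have hx : ((-(B + 2 * A * x) / 2 / (A * x ^ 2 + B * x + C : ℤ) : ℚ) : K) +
        ((1 / 2 / (A * x ^ 2 + B * x + C : ℤ) : ℚ) : K) * s =
        (-(B + 2 * A * x) + s) / (2 * (A * x ^ 2 + B * x + C : ℤ)) := by
      rw [div_div, div_div, Rat.cast_div, Rat.cast_div, div_mul_eq_mul_div, ← add_div]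
      push_cast
      ring
    have hG : (2 * (A * x ^ 2 + B * x + C : ℤ) : K) ≠ 0 := mul_ne_zero two_ne_zero hA'K
    rw [hx]
    constructor
    · rintro ⟨k, l, rfl⟩
      refine ⟨_, ⟨l, -(k + x * l), rfl⟩, ?_⟩
      rw [div_mul_eq_mul_div, eq_div_iff hG]
      push_cast
      linear_combination (k + x * l) / 2 * (hs - hfK)
    · rintro ⟨_, ⟨l, k, rfl⟩, rfl⟩
      refine ⟨-k - x * l, l, ?_⟩
      rw [div_mul_eq_mul_div, div_eq_iff hG]
      push_cast
      linear_combination k / 2 * (hs - hfK)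

theorem quadIdeal_translate {A B C : ℤ} (hf : B ^ 2 - 4 * A * C = D) (x : ℤ) :
    quadIdeal s A (B + 2 * A * x) = quadIdeal s A B := by
  ext y
  rw [h.mem_quadIdeal hf, h.mem_quadIdeal (C := A * x ^ 2 + B * x + C) (by linear_combination hf)]
  constructor
  · rintro ⟨k, l, rfl⟩
    exact ⟨k - l * x, l, by push_cast; ring⟩
  · rintro ⟨k, l, rfl⟩
    exact ⟨k + l * x, l, by push_cast; ring⟩

/-- Let e generate the ideal of ω-coordinates of J and f the ideal J ∩ ℤ. Stability under ω makes
everything divisible by e, and J = e(ℤA₀ + ℤ(g + ω)). -/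
theorem exists_form {J : Ideal (𝓞 K)} (hJ : J ≠ ⊥) : ∃ A B C e : ℤ, 0 < A ∧ e ≠ 0 ∧
    B ^ 2 - 4 * A * C = D ∧
    (J : FractionalIdeal (𝓞 K)⁰ K) = .spanSingleton (𝓞 K)⁰ (e : K) * quadIdeal s A B := by
  obtain ⟨ω, hω⟩ := h.mem_integers
  have hs := h.sq_eq
  have hD : (t : K) ^ 2 - 4 * n = D := by exact_mod_cast h.disc_eq
  have hω2 : ω ^ 2 = t * ω - n := by
    apply NumberField.RingOfIntegers.coe_injective
    simp only [map_pow, map_sub, map_mul, map_intCast, hω]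
    linear_combination (hs - hD) / 4
  have hc (r : 𝓞 K) : ∃ a b : ℤ, r = a + b * ω := by
    obtain ⟨a, b, hr⟩ := h.exists_coords r
    refine ⟨a, b, NumberField.RingOfIntegers.coe_injective ?_⟩
    simp only [map_add, map_mul, map_intCast, hω, hr]
  obtain ⟨f, hf0, hf⟩ : ∃ f : ℤ, f ≠ 0 ∧ ∀ x : ℤ, (x : 𝓞 K) ∈ J ↔ f ∣ x := by
    obtain ⟨f, hf⟩ := (IsPrincipalIdealRing.principal (J.comap (algebraMap ℤ (𝓞 K)))).1
    have hf' (x : ℤ) : (x : 𝓞 K) ∈ J ↔ f ∣ x := by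
      rw [← Ideal.mem_span_singleton, Ideal.span, ← hf]
      rfl
    refine ⟨f, ?_, hf'⟩
    rintro rfl
    have h1 := (hf' (Ideal.absNorm J)).1 (by exact_mod_cast Ideal.absNorm_mem J)
    rw [zero_dvd_iff] at h1
    exact hJ (Ideal.absNorm_eq_zero_iff.1 (by exact_mod_cast h1))
  obtain ⟨e, g, heg, he⟩ : ∃ e g : ℤ, g + e * ω ∈ J ∧ ∀ a b : ℤ, a + b * ω ∈ J → e ∣ b := by
    let H : Ideal ℤ :=
      { carrier := {b | ∃ a : ℤ, a + b * ω ∈ J}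
        add_mem' := by
          rintro b b' ⟨a, ha⟩ ⟨a', ha'⟩
          refine ⟨a + a', ?_⟩
          convert J.add_mem ha ha' using 1
          push_cast; ring
        zero_mem' := ⟨0, by simp⟩
        smul_mem' := by
          rintro c b ⟨a, ha⟩
          refine ⟨c * a, ?_⟩
          convert J.mul_mem_left c ha using 1
          simp only [smul_eq_mul]
          push_cast; ring }
    obtain ⟨e, hE⟩ := (IsPrincipalIdealRing.principal H).1
    have hE' (x : ℤ) : x ∈ H ↔ e ∣ x := by
      rw [← Ideal.mem_span_singleton, Ideal.span, ← hE]
    obtain ⟨g, hg⟩ := (hE' e).2 dvd_rfl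
    exact ⟨e, g, hg, fun a b hab => (hE' b).1 ⟨a, hab⟩⟩
  obtain ⟨A₀, rfl⟩ : e ∣ f := he 0 f (by
    simpa using J.mul_mem_right ω ((hf f).2 dvd_rfl))
  have he0 : e ≠ 0 := left_ne_zero_of_mul hf0
  obtain ⟨g, rfl⟩ : e ∣ g := by
    have h1 := he (-e * n) (g + e * t) (by
      convert J.mul_mem_right ω heg using 1
      push_cast
      linear_combination -e * hω2)
    rwa [dvd_add_left (dvd_mul_right e t)] at h1
  -- Multiplying e(g + ω) by the conjugate of g + ω gives an integer in J; so A₀ divides the norm of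
  -- g + ω.
  have h2 : e * A₀ ∣ e * (g ^ 2 + g * t + n) := by
    rw [← hf]
    convert J.mul_mem_right (g + t - ω) heg using 1
    push_cast
    linear_combination e * hω2
  rw [mul_dvd_mul_iff_left he0] at h2
  have hA0 : A₀ ≠ 0 := right_ne_zero_of_mul hf0
  obtain ⟨C, hC⟩ := (abs_dvd _ _).2 h2
  have hform : (-(2 * g + t)) ^ 2 - 4 * |A₀| * C = D := by
    linear_combination h.disc_eq + 4 * hC
  refine ⟨|A₀|, -(2 * g + t), C, e, abs_pos.2 hA0, he0, hform, ?_⟩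
  ext x
  rw [FractionalIdeal.mem_coeIdeal, FractionalIdeal.mem_singleton_mul]
  simp only [h.mem_quadIdeal hform]
  constructor
  · rintro ⟨r, hr, rfl⟩
    obtain ⟨a, b, rfl⟩ := hc r
    obtain ⟨l, rfl⟩ := he a b hr
    have h3 : e * A₀ ∣ a - l * (e * g) := by
      rw [← hf]
      convert J.sub_mem hr (J.mul_mem_left l heg) using 1
      push_cast
      ring
    rw [← mul_dvd_mul_iff_left he0] at h2
    obtain ⟨k, hk⟩ : e * |A₀| ∣ a - l * (e * g) :=
      (mul_dvd_mul_left e ((abs_dvd _ _).2 dvd_rfl)).trans h3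
    have hk' : (a : K) - l * (e * g) = e * (|A₀| : ℤ) * k := by exact_mod_cast hk
    refine ⟨_, ⟨k, l, rfl⟩, ?_⟩
    simp only [map_add, map_mul, map_intCast, hω]
    push_cast at hk' ⊢
    linear_combination hk'
  · rintro ⟨_, ⟨k, l, rfl⟩, rfl⟩
    refine ⟨((e * |A₀| * k : ℤ) : 𝓞 K) + l * ((e * g : ℤ) + e * ω),
      J.add_mem ((hf _).2 ?_) (J.mul_mem_left _ heg), ?_⟩
    · exact (mul_dvd_mul_left e ((dvd_abs _ _).2 dvd_rfl)).trans (dvd_mul_right _ _)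
    · simp only [map_add, map_mul, map_intCast, hω]
      push_cast
      ring

/-- Every narrow class contains an ideal `(A, (-B + √D) / 2)` with `A > 0`. -/
theorem exists_rep (c : NarrowClassGroup K) : ∃ (A B C : ℤ) (I : (FractionalIdeal (𝓞 K)⁰ K)ˣ),
    0 < A ∧ B ^ 2 - 4 * A * C = D ∧ (I : FractionalIdeal (𝓞 K)⁰ K) = quadIdeal s A B ∧
    NarrowClassGroup.mk K I = c := by
  obtain ⟨I, rfl⟩ := QuotientGroup.mk'_surjective _ c
  obtain ⟨a, J, ha, hI⟩ :=
    FractionalIdeal.exists_eq_spanSingleton_mul (I : FractionalIdeal (𝓞 K)⁰ K)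
  have haK : algebraMap (𝓞 K) K a ≠ 0 := by simpa using ha
  -- Writing I = a⁻²(aJ) instead of a⁻¹J makes the norm of the multiplier a square.
  have hJ : Ideal.span {a} * J ≠ ⊥ := by
    refine mul_ne_zero (by simpa using ha) ?_
    rintro rfl
    rw [Ideal.zero_eq_bot, FractionalIdeal.coeIdeal_bot, mul_zero] at hI
    exact I.ne_zero hI
  obtain ⟨A, B, C, e, hA, he, hf, hJe⟩ := h.exists_form hJ
  refine ⟨A, B, C, Units.mk0 _ (quadIdeal_ne_zero s B hA.ne'), hA, hf, rfl, ?_⟩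
  refine (h.mk_eq_of_norm_pos (x := (algebraMap (𝓞 K) K a)⁻¹ ^ 2 * (e : K)) ?_ ?_).symm
  · have h1 : Algebra.norm ℚ (e : K) = e ^ 2 := by
      have := h.norm_eq e 0
      simpa using this
    have h2 : Algebra.norm ℚ (algebraMap (𝓞 K) K a)⁻¹ ≠ 0 := by
      simpa [Algebra.norm_eq_zero_iff] using ha
    rw [map_mul, map_pow, h1]
    positivity
  · rw [Units.val_mk0, ← FractionalIdeal.spanSingleton_mul_spanSingleton, mul_assoc, ← hJe,
      FractionalIdeal.coeIdeal_mul, FractionalIdeal.coeIdeal_span_singleton, ← mul_assoc,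
      FractionalIdeal.spanSingleton_mul_spanSingleton, hI]
    congr 2
    field_simp

end IsQuadraticRoot
end Quadratic

/-! ### Values of binary quadratic forms -/

section Values

theorem exists_modEq_pos {A : ℤ} (B C r : ℤ) {m : ℤ} (hA : 0 < A) (hm : 0 < m) :
    ∃ x : ℤ, x ≡ r [ZMOD m] ∧ 0 < A * x ^ 2 + B * x + C := by
  have h1 := neg_abs_le B
  have h2 := neg_abs_le C
  have h3 := neg_abs_le r
  have h4 := abs_nonneg B
  have h5 := abs_nonneg C
  have h6 := abs_nonneg r
  generalize |B| = b at *
  generalize |C| = c at *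
  generalize |r| = d at *
  -- This shift makes x at least |B| + |C| + 1, where the quadratic term dominates.
  refine ⟨r + m * (d + b + c + 1), by simp [Int.ModEq], ?_⟩
  have hx : b + c + 1 ≤ r + m * (d + b + c + 1) := by nlinarith
  generalize r + m * (d + b + c + 1) = x at hx
  have hx0 : 0 < x := by linarith
  have e1 : x ^ 2 ≤ A * x ^ 2 := by nlinarith [sq_nonneg x]
  have e2 : -b * x ≤ B * x := by nlinarith
  have e3 : x * (c + 1) ≤ x * (x - b) := by nlinarith
  have e4 : c + 1 ≤ x * (c + 1) := by nlinarith
  linarith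

variable {N : ℤ} {A B C D δ : ℤ}

/-- Modulo N the form is the linear polynomial Bx + C, which is nonzero at 0 or at 1. -/
theorem exists_pos_not_dvd (hN : 1 < N) (hA : 0 < A) (hNA : N ∣ A) (hNB : ¬ N ∣ B) :
    ∃ x : ℤ, 0 < A * x ^ 2 + B * x + C ∧ ¬ N ∣ A * x ^ 2 + B * x + C := by
  obtain ⟨r, hr⟩ : ∃ r, ¬ N ∣ B * r + C := by
    by_cases hC : N ∣ C
    · exact ⟨1, by rwa [mul_one, dvd_add_left hC]⟩
    · exact ⟨0, by simpa using hC⟩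
  obtain ⟨x, hxr, hx⟩ := exists_modEq_pos B C r hA (by linarith : 0 < N)
  refine ⟨x, hx, fun h => hr ?_⟩
  obtain ⟨a, rfl⟩ := hNA
  obtain ⟨k, hk⟩ := hxr.dvd
  obtain ⟨l, hl⟩ := h
  exact ⟨l + B * k - a * x ^ 2, by linear_combination hl + B * hk⟩

/-- Let f(x) = Ax² + Bx + C and solve B + 2Ar ≡ -δ modulo N. Then 4A f(r) = (B + 2Ar)² - D is
divisible by N. Since f(r + N) - f(r) ≡ -Nδ modulo N², one of r, r + N gives a value not divisible
by N². -/
theorem exists_exactly_dvd_value (hN : Prime N) (hN2 : 2 < N) (hA : 0 < A) (hNA : ¬ N ∣ A)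
    (hf : B ^ 2 - 4 * A * C = D) (hD : ¬ N ∣ D) (hδ : δ ^ 2 ≡ D [ZMOD N]) :
    ∃ x : ℤ, 0 < A * x ^ 2 + B * x + C ∧ N ∣ A * x ^ 2 + B * x + C ∧
      ¬ N ^ 2 ∣ A * x ^ 2 + B * x + C ∧ -(B + 2 * A * x) ≡ δ [ZMOD N] := by
  have hN' : ¬ N ∣ 2 := fun h => by have := Int.le_of_dvd two_pos h; omega
  have hNδ : ¬ N ∣ δ := fun h => hD (by
    have := hδ.dvd
    rw [dvd_sub_left (h.trans (dvd_pow_self _ two_ne_zero))] at this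
    exact this)
  have h2A : IsCoprime (2 * A) N := by
    rw [isCoprime_comm, hN.coprime_iff_not_dvd]
    exact fun h => (hN.dvd_or_dvd h).elim hN' hNA
  obtain ⟨a, b, hab⟩ := h2A
  set r := a * (-B - δ) with hr
  have hr' : N ∣ B + 2 * A * r + δ := ⟨b * (B + δ), by
    rw [hr]; linear_combination (-B - δ) * hab⟩
  obtain ⟨r', hr1, hr2⟩ : ∃ r', N ∣ B + 2 * A * r' + δ ∧ ¬ N ^ 2 ∣ A * r' ^ 2 + B * r' + C := by
    by_contra! hcon
    have h1 := hcon r hr'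
    have h2 := hcon (r + N) (by
      rw [show B + 2 * A * (r + N) + δ = (B + 2 * A * r + δ) + N * (2 * A) by ring]
      exact dvd_add hr' (dvd_mul_right _ _))
    have h3 := dvd_sub h2 h1
    rw [show A * (r + N) ^ 2 + B * (r + N) + C - (A * r ^ 2 + B * r + C) =
      N * (B + 2 * A * r + δ + N * A - δ) by ring, sq, mul_dvd_mul_iff_left hN.ne_zero,
      dvd_sub_right (dvd_add hr' (dvd_mul_right _ _))] at h3
    exact hNδ h3
  obtain ⟨x, hxr, hx⟩ := exists_modEq_pos B C r' hA (by positivity : 0 < N ^ 2)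
  obtain ⟨k, hk⟩ := hxr.dvd
  have hxδ : N ∣ B + 2 * A * x + δ := by
    obtain ⟨l, hl⟩ := hr1
    exact ⟨l - 2 * A * N * k, by linear_combination hl - 2 * A * hk⟩
  refine ⟨x, hx, ?_, fun h => hr2 ?_, ?_⟩
  · have h1 : N ∣ 2 * 2 * A * (A * x ^ 2 + B * x + C) := by
      obtain ⟨l, hl⟩ := hxδ
      obtain ⟨j, hj⟩ := hδ.dvd
      exact ⟨l * (B + 2 * A * x - δ) - j, by linear_combination (B + 2 * A * x - δ) * hl - hj - hf⟩
    rcases hN.dvd_or_dvd h1 with h1 | h1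
    · rcases hN.dvd_or_dvd h1 with h1 | h1
      · exact absurd ((hN.dvd_or_dvd h1).elim id id) hN'
      · exact absurd h1 hNA
    · exact h1
  · obtain ⟨l, hl⟩ := h
    exact ⟨l + k * (A * (r' + x) + B), by linear_combination hl + (A * (r' + x) + B) * hk⟩
  · rw [Int.modEq_iff_dvd]
    convert hxδ using 1
    ring

theorem not_dvd_of_modEq (hD : ¬ N ∣ D) (hδ : δ ^ 2 ≡ D [ZMOD N])
    (hB : B ≡ δ [ZMOD N]) : ¬ N ∣ B := by
  intro h
  have h1 := ((hB.pow 2).trans hδ).dvd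
  rw [dvd_sub_left (h.trans (dvd_pow_self _ two_ne_zero))] at h1
  exact hD h1

end Values

/-! ### Heegner representatives and their equivalence under Γ₀(N) -/

section Quadratic

variable {K : Type*} [Field K] [NumberField K]

namespace IsQuadraticRoot

variable {s : K} {D t n : ℤ} (h : IsQuadraticRoot s D t n)
include h

/-- Every narrow class contains an ideal `(A, (-B + √D) / 2)` with `N` exactly dividing `A`, with
`B ≡ δ` modulo `N`, and with `C > 0` prime to `N`. -/
theorem exists_heegner_rep {N δ : ℤ} (hN : Prime N) (hN2 : 2 < N) (hD : ¬ N ∣ D)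
    (hδ : δ ^ 2 ≡ D [ZMOD N]) (c : NarrowClassGroup K) :
    ∃ (A B C : ℤ) (I : (FractionalIdeal (𝓞 K)⁰ K)ˣ),
      (0 < A ∧ N ∣ A ∧ ¬ N ^ 2 ∣ A ∧ B ≡ δ [ZMOD N] ∧ B ^ 2 - 4 * A * C = D ∧
      (I : FractionalIdeal (𝓞 K)⁰ K) = quadIdeal s A B ∧ NarrowClassGroup.mk K I = c) ∧
      0 < C ∧ ¬ N ∣ C := by
  -- A leading coefficient prime to N allows the congruence for B to be solved afterwards.
  obtain ⟨A, B, C, I, hA, hNA, hf, hI, rfl⟩ :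
      ∃ (A B C : ℤ) (I : (FractionalIdeal (𝓞 K)⁰ K)ˣ), 0 < A ∧ ¬ N ∣ A ∧
      B ^ 2 - 4 * A * C = D ∧ (I : FractionalIdeal (𝓞 K)⁰ K) = quadIdeal s A B ∧
      NarrowClassGroup.mk K I = c := by
    obtain ⟨A, B, C, I, hA, hf, hI, hc⟩ := h.exists_rep c
    by_cases hNA : N ∣ A
    · have hNB : ¬ N ∣ B := by
        intro hB
        apply hD
        rw [← hf]
        exact dvd_sub (hB.trans (dvd_pow_self _ two_ne_zero))
          ((hNA.mul_left 4).mul_right C)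
      obtain ⟨x, hx, hxN⟩ := exists_pos_not_dvd (C := C) (by linarith) hA hNA hNB
      refine ⟨_, -(B + 2 * A * x), A, Units.mk0 _ (quadIdeal_ne_zero s _ hx.ne'), hx, hxN,
        by linear_combination hf, rfl, ?_⟩
      rw [← hc]
      exact (h.mk_eq_of_swap hf x hA hx hI rfl).symm
    · exact ⟨A, B, C, I, hA, hNA, hf, hI, hc⟩
  obtain ⟨x, hx, hx1, hx2, hx3⟩ := exists_exactly_dvd_value hN hN2 hA hNA hf hD hδ
  have hc := h.mk_eq_of_swap hf x hA hx hI
    (Units.val_mk0 (quadIdeal_ne_zero s (-(B + 2 * A * x)) hx.ne'))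
  have hf' : (-(B + 2 * A * x)) ^ 2 - 4 * (A * x ^ 2 + B * x + C) * A = D := by
    linear_combination hf
  rw [hc]
  generalize A * x ^ 2 + B * x + C = A' at *
  generalize -(B + 2 * A * x) = B' at *
  -- Translation by y keeps the ideal and replaces the last coefficient by the value of the form at
  -- y, which can be made positive and prime to N.
  obtain ⟨y, hy, hyN⟩ := exists_pos_not_dvd (C := A) (by linarith) hx hx1
    (not_dvd_of_modEq hD hδ hx3)
  refine ⟨A', B' + 2 * A' * y, A' * y ^ 2 + B' * y + A, _, ⟨hx, hx1, hx2, ?_, ?_, ?_, rfl⟩, hy, hyN⟩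
  · refine Int.ModEq.trans ?_ hx3
    rw [Int.modEq_iff_dvd]
    obtain ⟨k, rfl⟩ := hx1
    exact ⟨-(2 * k * y), by ring⟩
  · linear_combination hf'
  · rw [Units.val_mk0, h.quadIdeal_translate hf']

/-- If ε = a + bβ, multiplication by ε sends the column (β, A) to M(β, A) with the integral matrix
below, and det M is the norm of ε. -/
theorem exists_automorph {A B C : ℤ} {N : ℕ} (hf : B ^ 2 - 4 * A * C = D) (hN : (N : ℤ) ∣ A)
    (ε : 𝓞 K) (hε : Algebra.norm ℚ (ε : K) = 1) {u v : ℚ} (huv : (ε : K) = u + v * s) :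
    ∃ M : CongruenceSubgroup.Gamma0 N, (M : SL(2, ℤ)).val.map (Int.cast : ℤ → ℚ) =
      !![u - B * v, -2 * C * v; 2 * A * v, u + B * v] := by
  obtain ⟨a, b, hab⟩ := h.exists_coords' (B := B) (h.two_dvd ⟨A * C, by linear_combination hf⟩) ε
  have h1 : (u + v * s : K) = ((a - b * B / 2 : ℚ) : K) + ((b / 2 : ℚ) : K) * s := by
    rw [← huv, hab]
    push_cast
    ring
  obtain ⟨hu, hv⟩ := h.inj h1
  rw [huv, h.norm_eq] at hε
  have hfQ : (B : ℚ) ^ 2 - 4 * A * C = D := by exact_mod_cast hf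
  have hdet : (a - b * B) * a - (-C * b) * (A * b) = 1 := by
    have : ((a - b * B) * a - (-C * b) * (A * b) : ℚ) = 1 := by
      rw [← hε, hu, hv, ← hfQ]
      ring
    exact_mod_cast this
  let M : SL(2, ℤ) := ⟨!![a - b * B, -C * b; A * b, a], by rw [Matrix.det_fin_two_of, hdet]⟩
  refine ⟨⟨M, CongruenceSubgroup.Gamma0_mem.2 ?_⟩, ?_⟩
  · exact (ZMod.intCast_zmod_eq_zero_iff_dvd _ N).2 (hN.mul_right b)
  · change (!![a - b * B, -C * b; A * b, a] : Matrix (Fin 2) (Fin 2) ℤ).map _ = _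
    ext i j
    fin_cases i <;> fin_cases j <;> simp [hu, hv] <;> ring

/-- The matrix relating the bases of two homothetic ideals. -/
theorem exists_change_basis {A B C A' B' C' : ℤ} (hf : B ^ 2 - 4 * A * C = D)
    (hf' : B' ^ 2 - 4 * A' * C' = D) (hA : 0 < A) (hA' : 0 < A') {p q : ℚ}
    (hpq : 0 < p ^ 2 - D * q ^ 2)
    (hI : quadIdeal s A B = .spanSingleton (𝓞 K)⁰ (p + q * s) * quadIdeal s A' B') :
    ∃ k l k' l' : ℤ, 0 < k * l' - k' * l ∧
      (A : ℚ) = (p ^ 2 - D * q ^ 2) * (k * l' - k' * l) * A' ∧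
      (A : ℚ) * A = (p ^ 2 - D * q ^ 2) * A' * (k ^ 2 * A' - k * l * B' + l ^ 2 * C') ∧
      (A : ℚ) * B = (p ^ 2 - D * q ^ 2) * A' *
        (-2 * k * k' * A' + (k * l' + k' * l) * B' - 2 * l * l' * C') ∧
      (A : ℚ) * C = (p ^ 2 - D * q ^ 2) * A' * (k' ^ 2 * A' - k' * l' * B' + l' ^ 2 * C') := by
  have hs := h.sq_eq
  have hfQ : (B : ℚ) ^ 2 - 4 * A * C = D := by exact_mod_cast hf
  have hfQ' : (B' : ℚ) ^ 2 - 4 * A' * C' = D := by exact_mod_cast hf'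
  have hmem (x : K) (hx : x ∈ quadIdeal s A B) :
      ∃ k l : ℤ, x = (p + q * s) * (k * A' + l * ((-B' + s) / 2)) := by
    rw [hI, FractionalIdeal.mem_singleton_mul] at hx
    obtain ⟨y, hy, rfl⟩ := hx
    obtain ⟨k, l, rfl⟩ := (h.mem_quadIdeal hf').1 hy
    exact ⟨k, l, rfl⟩
  obtain ⟨k, l, h1⟩ := hmem A ((h.mem_quadIdeal hf).2 ⟨1, 0, by simp⟩)
  obtain ⟨k', l', h2⟩ := hmem ((-B + s) / 2) ((h.mem_quadIdeal hf).2 ⟨0, 1, by simp⟩)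
  obtain ⟨e1, e2⟩ := h.inj (p := A) (q := 0) (p' := p * (k * A' - l * B' / 2) + q * D * (l / 2))
    (q' := p * (l / 2) + q * (k * A' - l * B' / 2)) (by
      push_cast
      linear_combination h1 + q * l / 2 * hs)
  obtain ⟨e3, e4⟩ := h.inj (p := - B / 2) (q := 1 / 2)
    (p' := p * (k' * A' - l' * B' / 2) + q * D * (l' / 2))
    (q' := p * (l' / 2) + q * (k' * A' - l' * B' / 2)) (by
      push_cast
      linear_combination h2 + q * l' / 2 * hs)
  set R1 := p * (k * A' - l * B' / 2) + q * D * (l / 2) with hR1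
  set R2 := p * (l / 2) + q * (k * A' - l * B' / 2) with hR2
  set R3 := p * (k' * A' - l' * B' / 2) + q * D * (l' / 2) with hR3
  set R4 := p * (l' / 2) + q * (k' * A' - l' * B' / 2) with hR4
  -- The determinant compares the two bases. The three other identities compare the norms of A and
  -- β, namely A² and AC, and the trace of A times the conjugate of β, namely -AB.
  have hdet : (A : ℚ) = (p ^ 2 - D * q ^ 2) * (k * l' - k' * l) * A' := by
    have : (p ^ 2 - D * q ^ 2) * (k * l' - k' * l) * A' = 2 * (R1 * R4 - R3 * R2) := by
      rw [hR1, hR2, hR3, hR4]; ring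
    rw [this, ← e1, ← e2, ← e3, ← e4]
    ring
  have hAQ : (0 : ℚ) < A := by exact_mod_cast hA
  have hAQ' : (0 : ℚ) < A' := by exact_mod_cast hA'
  refine ⟨k, l, k', l', ?_, hdet, ?_, ?_, ?_⟩
  · have : (0 : ℚ) < k * l' - k' * l := by
      rw [hdet] at hAQ
      exact (mul_pos_iff_of_pos_left hpq).1 ((mul_pos_iff_of_pos_right hAQ').1 hAQ)
    exact_mod_cast this
  · have : (p ^ 2 - D * q ^ 2) * A' * (k ^ 2 * A' - k * l * B' + l ^ 2 * C') =
        R1 * R1 - D * R2 * R2 := by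
      rw [hR1, hR2]; linear_combination -(p ^ 2 - D * q ^ 2) * l ^ 2 / 4 * hfQ'
    rw [this, ← e1, ← e2]
    ring
  · have : (p ^ 2 - D * q ^ 2) * A' *
        (-2 * k * k' * A' + (k * l' + k' * l) * B' - 2 * l * l' * C') =
        -2 * (R1 * R3 - D * R2 * R4) := by
      rw [hR1, hR2, hR3, hR4]; linear_combination (p ^ 2 - D * q ^ 2) * l * l' / 2 * hfQ'
    rw [this, ← e1, ← e2, ← e3]
    ring
  · have : (p ^ 2 - D * q ^ 2) * A' * (k' ^ 2 * A' - k' * l' * B' + l' ^ 2 * C') =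
        R3 * R3 - D * R4 * R4 := by
      rw [hR3, hR4]; linear_combination -(p ^ 2 - D * q ^ 2) * l' ^ 2 / 4 * hfQ'
    rw [this, ← e3, ← e4]
    linear_combination -(1 / 4) * hfQ

/-- Forms attached to ideals in the same narrow class are properly equivalent. -/
theorem exists_equiv_of_mk_eq [NumberField.IsTotallyReal K] {A B C A' B' C' : ℤ}
    (hf : B ^ 2 - 4 * A * C = D) (hf' : B' ^ 2 - 4 * A' * C' = D) (hA : 0 < A) (hA' : 0 < A')
    {I I' : (FractionalIdeal (𝓞 K)⁰ K)ˣ}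
    (hI : (I : FractionalIdeal (𝓞 K)⁰ K) = quadIdeal s A B)
    (hI' : (I' : FractionalIdeal (𝓞 K)⁰ K) = quadIdeal s A' B')
    (hII : NarrowClassGroup.mk K I = NarrowClassGroup.mk K I') :
    ∃ k l k' l' : ℤ, k * l' - k' * l = 1 ∧ A = k ^ 2 * A' - k * l * B' + l ^ 2 * C' ∧
      B = -2 * k * k' * A' + (k * l' + k' * l) * B' - 2 * l * l' * C' ∧
      C = k' ^ 2 * A' - k' * l' * B' + l' ^ 2 * C' := by
  obtain ⟨x, hx, hxI⟩ := exists_norm_pos_of_mk_eq hII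
  rw [hI, hI'] at hxI
  have hx0 : x ≠ 0 := by
    rintro rfl
    simp [Algebra.norm_zero] at hx
  obtain ⟨p, q, hpq⟩ := h.eq_add_mul x
  obtain ⟨p', q', hpq'⟩ := h.eq_add_mul x⁻¹
  have hn : Algebra.norm ℚ x = p ^ 2 - D * q ^ 2 := by rw [hpq, h.norm_eq]
  have hn' : (Algebra.norm ℚ x)⁻¹ = p' ^ 2 - D * q' ^ 2 := by
    rw [← h.norm_eq, ← hpq']
    apply inv_eq_of_mul_eq_one_right
    rw [← map_mul, mul_inv_cancel₀ hx0, map_one]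
  have hxI' : quadIdeal s A' B' = .spanSingleton (𝓞 K)⁰ (p' + q' * s) * quadIdeal s A B := by
    rw [hxI, ← hpq', ← mul_assoc, FractionalIdeal.spanSingleton_mul_spanSingleton,
      inv_mul_cancel₀ hx0, FractionalIdeal.spanSingleton_one, one_mul]
  rw [hpq] at hxI
  obtain ⟨k, l, k', l', hd, h1, h2, h3, h4⟩ :=
    h.exists_change_basis hf hf' hA hA' (hn ▸ hx) hxI
  -- The inverse multiplier gives a second positive integral determinant; their product is 1, so
  -- both are 1.
  obtain ⟨i, j, i', j', hd', h1', -⟩ :=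
    h.exists_change_basis hf' hf hA' hA (hn' ▸ inv_pos.2 hx) hxI'
  rw [← hn] at h1 h2 h3 h4
  rw [← hn'] at h1'
  have hAQ : (A : ℚ) ≠ 0 := by exact_mod_cast hA.ne'
  have hAQ' : (A' : ℚ) ≠ 0 := by exact_mod_cast hA'.ne'
  have hdd : (k * l' - k' * l) * (i * j' - i' * j) = 1 := by
    have : ((k * l' - k' * l) * (i * j' - i' * j) : ℚ) = 1 := by
      have h5 : (A : ℚ) * A' * ((k * l' - k' * l) * (i * j' - i' * j) : ℚ) = A * A' := by
        calc _ = (Algebra.norm ℚ x * (k * l' - k' * l) * A') *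
              ((Algebra.norm ℚ x)⁻¹ * (i * j' - i' * j) * A) := by field_simp
          _ = _ := by rw [← h1, ← h1']
      exact mul_left_cancel₀ (mul_ne_zero hAQ hAQ') (by rw [h5, mul_one])
    exact_mod_cast this
  have hd1 : k * l' - k' * l = 1 := by
    rcases Int.mul_eq_one_iff_eq_one_or_neg_one.1 hdd with h | h
    · exact h.1
    · omega
  have hd1Q : (k * l' - k' * l : ℚ) = 1 := by exact_mod_cast hd1
  rw [hd1Q, mul_one] at h1
  rw [← h1] at h2 h3 h4
  refine ⟨k, l, k', l', hd1, ?_, ?_, ?_⟩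
  · exact_mod_cast mul_left_cancel₀ hAQ h2
  · exact_mod_cast mul_left_cancel₀ hAQ h3
  · exact_mod_cast mul_left_cancel₀ hAQ h4

/-- Both matrices represent multiplication by ε, so the change of basis conjugates one into the
other. It remains to see that it lies in Γ₀(N). -/
theorem cycle_eq_of_mk_eq [NumberField.IsTotallyReal K] {A B C A' B' C' δ : ℤ} {N : ℕ}
    (hN : Prime (N : ℤ)) (hN2 : 2 < (N : ℤ)) (hD : ¬ (N : ℤ) ∣ D) (hδ : δ ^ 2 ≡ D [ZMOD N])
    (hf : B ^ 2 - 4 * A * C = D) (hf' : B' ^ 2 - 4 * A' * C' = D) (hA : 0 < A) (hA' : 0 < A')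
    (hNA : (N : ℤ) ∣ A) (hNA' : (N : ℤ) ∣ A') (hB : B ≡ δ [ZMOD N]) (hB' : B' ≡ δ [ZMOD N])
    {I I' : (FractionalIdeal (𝓞 K)⁰ K)ˣ}
    (hI : (I : FractionalIdeal (𝓞 K)⁰ K) = quadIdeal s A B)
    (hI' : (I' : FractionalIdeal (𝓞 K)⁰ K) = quadIdeal s A' B')
    (hII : NarrowClassGroup.mk K I = NarrowClassGroup.mk K I') {u v : ℚ}
    {M M' : CongruenceSubgroup.Gamma0 N}
    (hM : (M : SL(2, ℤ)).val.map (Int.cast : ℤ → ℚ) =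
      !![u - B * v, -2 * C * v; 2 * A * v, u + B * v])
    (hM' : (M' : SL(2, ℤ)).val.map (Int.cast : ℤ → ℚ) =
      !![u - B' * v, -2 * C' * v; 2 * A' * v, u + B' * v]) :
    X0.cycle N M = X0.cycle N M' := by
  obtain ⟨k, l, k', l', hd, h1, h2, h3⟩ := h.exists_equiv_of_mk_eq hf hf' hA hA' hI hI' hII
  -- Otherwise N divides lC' - kB', whence B ≡ -B' and 2δ ≡ 0 modulo N.
  have hNl : (N : ℤ) ∣ l := by
    by_contra hl
    have e1 : (N : ℤ) ∣ l * (l * C' - k * B') := by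
      rw [show l * (l * C' - k * B') = A - A' * k ^ 2 by rw [h1]; ring]
      exact dvd_sub hNA (hNA'.mul_right _)
    have e2 := (hN.dvd_or_dvd e1).resolve_left hl
    obtain ⟨a, ha⟩ := hNA'
    obtain ⟨b, hb⟩ := e2
    obtain ⟨c, hc⟩ := hB.dvd
    obtain ⟨c', hc'⟩ := hB'.dvd
    have e3 : (N : ℤ) ∣ 2 * δ := ⟨c + c' - 2 * k * k' * a - 2 * l' * b, by
      linear_combination hc + hc' + h2 - B' * hd - 2 * k * k' * ha - 2 * l' * hb⟩
    have hN' : ¬ (N : ℤ) ∣ 2 := fun h => by have := Int.le_of_dvd two_pos h; omega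
    have e4 := (hN.dvd_or_dvd e3).resolve_left hN'
    exact not_dvd_of_modEq hD hδ (Int.ModEq.refl δ) e4
  -- Up to the multiplier, the column (β, A) is g₀ times the column (β', A').
  let g₀ : SL(2, ℤ) := ⟨!![l', k'; l, k], by rw [Matrix.det_fin_two_of]; linear_combination hd⟩
  let g : CongruenceSubgroup.Gamma0 N := ⟨g₀, CongruenceSubgroup.Gamma0_mem.2
    ((ZMod.intCast_zmod_eq_zero_iff_dvd _ N).2 hNl)⟩
  have hMg : M * g = g * M' := by
    have hm (i j : Fin 2) : ((M : SL(2, ℤ)).val i j : ℚ) = _ := congrFun (congrFun hM i) j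
    have hm' (i j : Fin 2) : ((M' : SL(2, ℤ)).val i j : ℚ) = _ := congrFun (congrFun hM' i) j
    have hdQ : (k * l' - k' * l : ℚ) = 1 := by exact_mod_cast hd
    apply Subtype.ext
    apply Subtype.ext
    have hg : (g : SL(2, ℤ)).val = !![l', k'; l, k] := rfl
    ext i j
    rw [← Int.cast_inj (α := ℚ)]
    simp only [Subgroup.coe_mul, Matrix.SpecialLinearGroup.coe_mul, Matrix.mul_apply,
      Fin.sum_univ_two, Int.cast_add, Int.cast_mul, hm, hm', hg]
    fin_cases i <;> fin_cases j <;> simp [h1, h2, h3]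
    · linear_combination v * (2 * k' * A' - l' * B') * hdQ
    · linear_combination v * (B' * k' - 2 * l' * C') * hdQ
    · linear_combination v * (2 * k * A' - l * B') * hdQ
    · linear_combination v * (k * B' - 2 * l * C') * hdQ
  rw [← X0.cycle_conj N g M', ← hMg, mul_inv_cancel_right]

end IsQuadraticRoot
end Quadratic

/-! ### Products of ideals and the class of 𝔑 -/

section Quadratic

variable {K : Type*} [Field K] [NumberField K]

namespace IsQuadraticRoot

variable {s : K} {D t n : ℤ} (h : IsQuadraticRoot s D t n)
include h

/-- A form whose discriminant is fundamental is primitive. -/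
theorem exists_bezout {A B C : ℤ} (hf : B ^ 2 - 4 * A * C = D) :
    ∃ x y z : ℤ, x * A + y * B + z * C = 1 := by
  obtain ⟨A', hA⟩ := (Int.gcd_dvd_left (Int.gcd A B : ℤ) C).trans (Int.gcd_dvd_left A B)
  obtain ⟨B', hB⟩ := (Int.gcd_dvd_left (Int.gcd A B : ℤ) C).trans (Int.gcd_dvd_right A B)
  obtain ⟨C', hC⟩ := Int.gcd_dvd_right (Int.gcd A B : ℤ) C
  have hbez : ∃ x y z : ℤ, x * A + y * B + z * C = (Int.gcd (Int.gcd A B : ℤ) C : ℤ) := by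
    have e1 := Int.gcd_eq_gcd_ab (Int.gcd A B : ℤ) C
    have e2 := Int.gcd_eq_gcd_ab A B
    exact ⟨Int.gcdA A B * Int.gcdA (Int.gcd A B : ℤ) C, Int.gcdB A B * Int.gcdA (Int.gcd A B : ℤ) C,
      Int.gcdB (Int.gcd A B : ℤ) C,
      by linear_combination -e1 - Int.gcdA (Int.gcd A B : ℤ) C * e2⟩
  generalize (Int.gcd (Int.gcd A B : ℤ) C : ℤ) = d at *
  have hd : d ≠ 0 := by
    rintro rfl
    apply h.ne_cast 0
    have : D = 0 := by rw [← hf, hA, hB]; ring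
    have hs := h.sq_eq
    rw [this, Int.cast_zero, sq_eq_zero_iff] at hs
    rw [hs, Rat.cast_zero]
  have hdK : (d : K) ≠ 0 := by exact_mod_cast hd
  have hsq := h.quad_sq hf
  -- If d divides A, B and C, then β/d is a root of X² + (B/d)X + AC/d², hence integral. Its
  -- coordinates in 1, β then force d to be a unit.
  obtain ⟨a, b, hab⟩ : ∃ a b : ℤ, ((-B + s) / 2 / d : K) = a + b * ((-B + s) / 2) := by
    have hint : IsIntegral ℤ ((-B + s) / 2 / d : K) := by
      refine ⟨.X ^ 2 + .C B' * .X + .C (A' * C'), by monicity!, ?_⟩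
      simp only [Polynomial.eval₂_add, Polynomial.eval₂_mul, Polynomial.eval₂_pow,
        Polynomial.eval₂_X, Polynomial.eval₂_C]
      simp only [eq_intCast]
      have h1 : (A : K) = d * A' := by exact_mod_cast hA
      have h2 : (B : K) = d * B' := by exact_mod_cast hB
      have h3 : (C : K) = d * C' := by exact_mod_cast hC
      generalize ((-B + s) / 2 : K) = β at *
      rw [h1, h2, h3] at hsq
      push_cast
      field_simp
      linear_combination hsq
    exact h.exists_coords' (h.two_dvd ⟨A * C, by linear_combination hf⟩) ⟨_, hint⟩
  have h1 : ((-B / 2 / d : ℚ) + (1 / 2 / d : ℚ) * s : K) =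
      (a - b * B / 2 : ℚ) + (b / 2 : ℚ) * s := by
    push_cast
    linear_combination hab
  obtain ⟨-, h2⟩ := h.inj h1
  have hdQ : (d : ℚ) ≠ 0 := by exact_mod_cast hd
  have h3 : b * d = 1 := by
    field_simp at h2
    rw [mul_comm]
    exact_mod_cast h2.symm
  obtain ⟨x, y, z, hxyz⟩ := hbez
  exact ⟨b * x, b * y, b * z, by linear_combination b * hxyz + h3⟩

/-- The product of the ideals `(N A, β)` and `(N C, β)`, for `β = (-B + √D) / 2` a root of
`X² + B X + N A C`. -/
theorem quadIdeal_mul {A B C N : ℤ} (hf : B ^ 2 - 4 * (N * A) * C = D) :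
    quadIdeal s (N * A) B * quadIdeal s (N * C) B =
      .spanSingleton (𝓞 K)⁰ ((-B + s) / 2) * quadIdeal s N B := by
  have hf1 : B ^ 2 - 4 * (N * C) * A = D := by linear_combination hf
  have hf2 : B ^ 2 - 4 * N * (A * C) = D := by linear_combination hf
  have hsq := h.quad_sq hf2
  push_cast at hsq
  -- Since N²AC = -Nβ(β + B), the product is β times the ideal generated by NA, NB, NC and β.
  -- Primitivity of (A, B, NC) puts N in that ideal.
  obtain ⟨x, y, z, hxyz⟩ := h.exists_bezout (A := A) (B := B) (C := N * C)
    (by linear_combination hf)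
  have hxyzK : (x * A + y * B + z * (N * C) : K) = 1 := by exact_mod_cast hxyz
  apply le_antisymm
  · refine FractionalIdeal.mul_le.2 fun i hi j hj => ?_
    obtain ⟨k, l, rfl⟩ := (h.mem_quadIdeal hf).1 hi
    obtain ⟨k', l', rfl⟩ := (h.mem_quadIdeal hf1).1 hj
    refine FractionalIdeal.mem_singleton_mul.2 ⟨_, (h.mem_quadIdeal hf2).2
      ⟨k * l' * A + k' * l * C - k * k' * B, l * l' - k * k' * N, rfl⟩, ?_⟩
    push_cast
    linear_combination k * k' * N * hsq
  · intro _ hw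
    obtain ⟨_, hv, rfl⟩ := FractionalIdeal.mem_singleton_mul.1 hw
    obtain ⟨k, l, rfl⟩ := (h.mem_quadIdeal hf2).1 hv
    have hm {a b a' b' : ℤ} := FractionalIdeal.mul_mem_mul
      ((h.mem_quadIdeal hf).2 ⟨a, b, rfl⟩) ((h.mem_quadIdeal hf1).2 ⟨a', b', rfl⟩)
    have h1 := hm (a := 1) (b := 0) (a' := -k * y) (b' := k * x)
    have h2 := hm (a := 0) (b := 1) (a' := k * z * N) (b' := l - k * y * N)
    have hadd {v w : K} (P : FractionalIdeal (𝓞 K)⁰ K) (hv : v ∈ P) (hw : w ∈ P) : v + w ∈ P :=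
      Submodule.add_mem (P : Submodule (𝓞 K) K) hv hw
    refine (congrArg (· ∈ quadIdeal s (N * A) B * quadIdeal s (N * C) B) ?_).mpr (hadd _ h1 h2)
    push_cast
    linear_combination -k * N * ((-B + s) / 2) * hxyzK + k * y * N * hsq

/-- The factor β in the product of the two ideals has norm NAC, positive because C > 0, so it
disappears in the narrow class group. -/
theorem mk_mul_mk {A B C N δ : ℤ} (hf : B ^ 2 - 4 * (N * A) * C = D) (hA : 0 < N * A) (hC : 0 < C)
    (hN : Prime N) (hN2 : 2 < N) (hB : B ≡ δ [ZMOD N])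
    {I I' : (FractionalIdeal (𝓞 K)⁰ K)ˣ}
    (hI : (I : FractionalIdeal (𝓞 K)⁰ K) = quadIdeal s (N * A) B)
    (hI' : (I' : FractionalIdeal (𝓞 K)⁰ K) = quadIdeal s (N * C) B)
    {P : IsDedekindDomain.HeightOneSpectrum (𝓞 K)}
    (hP : (P.asIdeal : FractionalIdeal (𝓞 K)⁰ K) = quadIdeal s N δ) :
    NarrowClassGroup.mk K I * NarrowClassGroup.mk K I' = NarrowClassGroup.ofPrime K P := by
  have hf2 : B ^ 2 - 4 * N * (A * C) = D := by linear_combination hf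
  -- Both (-δ + s)/2, an element of 𝔑, and β are integral, so their difference (B - δ)/2 is an
  -- integer. With B ≡ δ modulo N this makes (N, β) equal to 𝔑.
  have hδ2 : 2 ∣ B - δ := by
    have h1 : ((-δ + s) / 2 : K) ∈ (P.asIdeal : FractionalIdeal (𝓞 K)⁰ K) := by
      rw [hP, quadIdeal, FractionalIdeal.mem_add]
      exact ⟨0, FractionalIdeal.zero_mem _, _, FractionalIdeal.mem_spanSingleton_self _ _,
        zero_add _⟩
    obtain ⟨r, -, hr⟩ := (FractionalIdeal.mem_coeIdeal _).1 h1
    obtain ⟨a, b, hab⟩ := h.exists_coords'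
      (h.two_dvd (B := B) ⟨N * A * C, by linear_combination hf⟩) r
    rw [show ((r : 𝓞 K) : K) = _ from hr] at hab
    obtain ⟨h2, h3⟩ := h.inj (p := -δ / 2) (q := 1 / 2) (p' := a - b * B / 2) (q' := b / 2) (by
      push_cast
      linear_combination hab)
    refine ⟨a, ?_⟩
    have : (B - δ : ℚ) = 2 * a := by linear_combination 2 * h2 + 2 * B * h3
    exact_mod_cast this
  obtain ⟨j, hj⟩ : 2 * N ∣ B - δ := by
    refine IsCoprime.mul_dvd ?_ hδ2 hB.symm.dvd
    rw [isCoprime_comm, hN.coprime_iff_not_dvd]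
    exact fun h => by have := Int.le_of_dvd two_pos h; omega
  have hNδ : quadIdeal s N B = quadIdeal s N δ := by
    rw [← h.quadIdeal_translate hf2 (-j)]
    congr 1
    linear_combination hj
  rw [← map_mul, NarrowClassGroup.ofPrime]
  refine h.mk_eq_of_norm_pos (x := (-B / 2 : ℚ) + (1 / 2 : ℚ) * s) ?_ ?_
  · rw [h.norm_eq]
    have hfQ : (B : ℚ) ^ 2 - 4 * (N * A) * C = D := by exact_mod_cast hf
    have h1 : (0 : ℚ) < N * A := by exact_mod_cast hA
    have h2 : (0 : ℚ) < C := by exact_mod_cast hC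
    rw [← hfQ]
    nlinarith [mul_pos h1 h2]
  · rw [Units.val_mul, hI, hI', h.quadIdeal_mul hf, FractionalIdeal.coe_mk0, hP, hNδ]
    congr 2
    push_cast
    ring

end IsQuadraticRoot

end Quadratic

/-! ### The action of W_N and c on cycles -/

/-- Conjugation by diag(-1, 1) negates the off-diagonal entries; the Atkin-Lehner matrix then yields
(d, c; Nb, a), the inverse of M'. The inverse accounts for the minus sign. -/
theorem X0.map_atkinLehner_complexConj_cycle {N : ℕ} [NeZero N]
    {M M' : CongruenceSubgroup.Gamma0 N} {a b c d : ℤ}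
    (hM : (M : SL(2, ℤ)).val = !![a, b; N * c, d]) (hM' : (M' : SL(2, ℤ)).val = !![a, -c; -N * b, d]) :
    H1.map (X0.atkinLehner N) (H1.map (X0.complexConj N) (X0.cycle N M)) = -X0.cycle N M' := by
  have hdet := M.1.det_coe
  rw [hM, Matrix.det_fin_two_of] at hdet
  let M₁ : CongruenceSubgroup.Gamma0 N := ⟨⟨!![a, -b; -(N * c), d], by
    rw [Matrix.det_fin_two_of]; linear_combination hdet⟩, CongruenceSubgroup.Gamma0_mem.2
      (by simp)⟩
  have hM₁ : (M₁ : SL(2, ℤ)).val = !![a, -b; -(N * c), d] := rfl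
  have hM'i : ((M'⁻¹ : CongruenceSubgroup.Gamma0 N) : SL(2, ℤ)).val = !![d, c; N * b, a] := by
    rw [Subgroup.coe_inv, Matrix.SpecialLinearGroup.coe_inv, hM', Matrix.adjugate_fin_two_of]
    simp
  rw [← X0.cycle_inv, X0.complexConj, X0.atkinLehner,
    X0.map_mapOfNormalizes_cycle N conjMatrix _ M M₁, X0.map_mapOfNormalizes_cycle]
  · generalize M'⁻¹ = M'' at hM'i
    ext i j
    fin_cases i <;> fin_cases j <;>
      simp [X0.atkinLehnerMatrix, Matrix.mul_apply, Fin.sum_univ_two, X0.mapGL_apply, hM₁, hM'i,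
        -Matrix.SpecialLinearGroup.mapGL_coe_matrix, mul_comm]
  · ext i j
    fin_cases i <;> fin_cases j <;>
      simp [X0.conjMatrix, Matrix.mul_apply, Fin.sum_univ_two, X0.mapGL_apply, hM₁, hM,
        -Matrix.SpecialLinearGroup.mapGL_coe_matrix]

theorem H1.mapComplex_tmul {X Y : Type} [TopologicalSpace X] [TopologicalSpace Y] (f : C(X, Y))
    (a : ℂ) (γ : H1 X) : H1.mapComplex f (a ⊗ₜ γ) = a ⊗ₜ H1.map f γ := rfl

theorem conjCoeff_tmul {X : Type} [TopologicalSpace X] (a : ℂ) (γ : H1 X) :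
    conjCoeff X (a ⊗ₜ γ) = starRingEnd ℂ a ⊗ₜ γ := rfl

/-- The values are roots of unity, hence of absolute value 1. -/
theorem conj_character {G : Type*} [Group G] [Finite G] (χ : G →* ℂˣ) (g : G) :
    starRingEnd ℂ ((χ g)⁻¹ : ℂˣ).val = (χ g : ℂ) := by
  have : ‖(χ g : ℂ)‖ = 1 := by
    refine Complex.norm_eq_one_of_pow_eq_one (n := Nat.card G) ?_ Nat.card_pos.ne'
    rw [← Units.val_pow_eq_pow_val, ← map_pow, pow_card_eq_one', map_one, Units.val_one]
  rw [Units.val_inv_eq_inv_val, Complex.inv_eq_conj this, Complex.conj_conj]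

/-! ### Existence, uniqueness and symmetry of Heegner cycles -/

section Heegner

variable {K : Type*} [Field K] [NumberField K] {s : K} {t n : ℤ}
  {N : ℕ} {δ : ℤ} {ε : (𝓞 K)ˣ}

theorem IsHeegnerCycle.eq [NumberField.IsTotallyReal K] (h : IsQuadraticRoot s (NumberField.discr K) t n)
    (hN : Prime (N : ℤ)) (hN2 : 2 < (N : ℤ)) (hD : ¬ (N : ℤ) ∣ NumberField.discr K)
    (hδ : δ ^ 2 ≡ NumberField.discr K [ZMOD N]) {c : NarrowClassGroup K} {γ γ' : H1 (X0 N)}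
    (hγ : IsHeegnerCycle N s ε δ c γ) (hγ' : IsHeegnerCycle N s ε δ c γ') : γ = γ' := by
  obtain ⟨A, B, C, I, u, v, M, z, p, hA, hNA, -, hB, hf, hI, hc, huv, hM, rfl⟩ := hγ
  obtain ⟨A', B', C', I', u', v', M', z', p', hA', hNA', -, hB', hf', hI', hc', huv', hM', rfl⟩ :=
    hγ'
  obtain ⟨rfl, rfl⟩ := h.inj (huv.symm.trans huv')
  rw [X0.pathClass_eq_cycle, X0.pathClass_eq_cycle]
  exact h.cycle_eq_of_mk_eq hN hN2 hD hδ hf hf' hA hA' hNA hNA' hB hB' hI hI'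
    (hc.trans hc'.symm) hM hM'

/-- The forms (NA₁, B, C) and (NC, B, A₁) have the same discriminant and middle coefficient. Their
matrices are exchanged up to inversion by W_N c, and their classes multiply to that of 𝔑. -/
theorem exists_isHeegnerCycle_pair (h : IsQuadraticRoot s (NumberField.discr K) t n) [NeZero N]
    (hN : Prime (N : ℤ)) (hN2 : 2 < (N : ℤ)) (hD : ¬ (N : ℤ) ∣ NumberField.discr K)
    (hδ : δ ^ 2 ≡ NumberField.discr K [ZMOD N])
    (hε : Algebra.norm ℚ ((ε : 𝓞 K) : K) = 1) {P : IsDedekindDomain.HeightOneSpectrum (𝓞 K)}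
    (hP : (P.asIdeal : FractionalIdeal (𝓞 K)⁰ K) = quadIdeal s N δ) (c : NarrowClassGroup K) :
    ∃ γ γ' : H1 (X0 N), IsHeegnerCycle N s ε δ c γ ∧
      IsHeegnerCycle N s ε δ (NarrowClassGroup.ofPrime K P * c⁻¹) γ' ∧
      H1.map (X0.atkinLehner N) (H1.map (X0.complexConj N) γ) = -γ' := by
  obtain ⟨A, B, C, I, ⟨hA, hNA, hNA2, hB, hf, hI, hc⟩, hC, hNC⟩ :=
    h.exists_heegner_rep hN hN2 hD hδ c
  obtain ⟨u, v, huv⟩ := h.eq_add_mul ((ε : 𝓞 K) : K)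
  obtain ⟨M, hM⟩ := h.exists_automorph hf hNA ε hε huv
  obtain ⟨A₁, rfl⟩ := hNA
  have hNC0 : 0 < (N : ℤ) * C := by positivity
  have hA₁ : 0 < A₁ := pos_of_mul_pos_right hA (by positivity)
  have hf' : B ^ 2 - 4 * (N * C) * A₁ = NumberField.discr K := by linear_combination hf
  obtain ⟨M', hM'⟩ := h.exists_automorph hf' (dvd_mul_right _ _) ε hε huv
  let I' : (FractionalIdeal (𝓞 K)⁰ K)ˣ := Units.mk0 _ (IsQuadraticRoot.quadIdeal_ne_zero s B hNC0.ne')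
  have hII := h.mk_mul_mk hf hA hC hN hN2 hB hI (I' := I') rfl hP
  refine ⟨X0.cycle N M, X0.cycle N M', ⟨_, B, C, I, u, v, M, _, _, hA, dvd_mul_right _ _, hNA2, hB,
    hf, hI, hc, huv, hM, rfl⟩, ⟨_, B, A₁, I', u, v, M', _, _, hNC0, dvd_mul_right _ _, ?_, hB, hf',
    rfl, ?_, huv, hM', rfl⟩, ?_⟩
  · rwa [sq, mul_dvd_mul_iff_left hN.ne_zero]
  · rw [← hc, ← hII]
    exact (mul_inv_cancel_comm _ _).symm
  · have hm (i j : Fin 2) : ((M : SL(2, ℤ)).val i j : ℚ) = _ := congrFun (congrFun hM i) j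
    have hm' (i j : Fin 2) : ((M' : SL(2, ℤ)).val i j : ℚ) = _ := congrFun (congrFun hM' i) j
    have hN0 : (N : ℚ) ≠ 0 := by exact_mod_cast hN.ne_zero
    -- The integer -M'₀₁ = 2A₁v is the lower left entry of M divided by N.
    refine X0.map_atkinLehner_complexConj_cycle (a := M.1 0 0) (b := M.1 0 1) (c := - M'.1 0 1)
      (d := M.1 1 1) ?_ ?_
    · ext i j
      rw [← Int.cast_inj (α := ℚ)]
      fin_cases i <;> fin_cases j <;> simp [hm, hm']
      ring
    · ext i j
      rw [← Int.cast_inj (α := ℚ)]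
      fin_cases i <;> fin_cases j <;> simp [hm, hm']
      ring

end Heegner

end

theorem lemma3p4 {K : Type*} [Field K] [NumberField K] [NumberField.IsTotallyReal K]
    (hK : Module.finrank ℚ K = 2)
    (s : K) (hs : s ^ 2 = (NumberField.discr K : K))
    (ε : (𝓞 K)ˣ) (hε1 : Algebra.norm ℚ ((ε : 𝓞 K) : K) = 1)
    (hε : ∀ η : (𝓞 K)ˣ, Algebra.norm ℚ ((η : 𝓞 K) : K) = 1 → ∃ n : ℤ, η = ε ^ n ∨ η = -ε ^ n)
    (N : ℕ) [NeZero N] (hN : N.Prime) (hN5 : 5 ≤ N) (hND : ¬ (N : ℤ) ∣ NumberField.discr K)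
    (𝔑 : IsDedekindDomain.HeightOneSpectrum (𝓞 K)) (δ : ℤ)
    (hδ : δ ^ 2 ≡ NumberField.discr K [ZMOD N])
    (h𝔑 : (𝔑.asIdeal : FractionalIdeal (𝓞 K)⁰ K) = quadIdeal s N δ) :
    (∀ c : NarrowClassGroup K, ∃! γ : H1 (X0 N), IsHeegnerCycle N s ε δ c γ) ∧
    ∀ χ : NarrowClassGroup K →* ℂˣ,
      conjCoeff (X0 N) (heegnerSum N s ε δ χ) =
        -((χ (NarrowClassGroup.ofPrime K 𝔑) : ℂ) •
          H1.mapComplex (X0.atkinLehner N)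
            (H1.mapComplex (X0.complexConj N) (heegnerSum N s ε δ χ))) := by
  obtain ⟨t, n, h⟩ := exists_isQuadraticRoot hK hs
  have hNp : Prime (N : ℤ) := Nat.prime_iff_prime_int.1 hN
  have hN2 : 2 < (N : ℤ) := by omega
  have h𝔑' : (𝔑.asIdeal : FractionalIdeal (𝓞 K)⁰ K) = quadIdeal s (N : ℤ) δ := by simpa using h𝔑
  have hpair := exists_isHeegnerCycle_pair h hNp hN2 hND hδ hε1 h𝔑'
  have huniq {c : NarrowClassGroup K} {γ γ' : H1 (X0 N)} (hγ : IsHeegnerCycle N s ε δ c γ)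
    (hγ' : IsHeegnerCycle N s ε δ c γ') : γ = γ' := hγ.eq h hNp hN2 hND hδ hγ'
  have hspec (c : NarrowClassGroup K) : IsHeegnerCycle N s ε δ c (heegnerCycle N s ε δ c) := by
    obtain ⟨γ, -, hγ, -⟩ := hpair c
    exact Classical.epsilon_spec ⟨γ, hγ⟩
  refine ⟨fun c => ⟨_, hspec c, fun γ hγ => huniq hγ (hspec c)⟩, fun χ => ?_⟩
  set p := NarrowClassGroup.ofPrime K 𝔑 with hp
  have hWc (c : NarrowClassGroup K) : H1.map (X0.atkinLehner N) (H1.map (X0.complexConj N)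
      (heegnerCycle N s ε δ c)) = -heegnerCycle N s ε δ (p * c⁻¹) := by
    obtain ⟨γ, γ', hγ, hγ', hW⟩ := hpair c
    rw [huniq (hspec c) hγ, huniq (hspec _) hγ', hW]
  simp only [heegnerSum, map_sum, conjCoeff_tmul, H1.mapComplex_tmul, hWc, conj_character,
    Finset.smul_sum, ← Finset.sum_neg_distrib, TensorProduct.smul_tmul', TensorProduct.tmul_neg,
    smul_neg, neg_neg]
  -- The two sums match under the involution c ↦ 𝔑c⁻¹, since χ(𝔑)χ(c)⁻¹ = χ(𝔑c⁻¹).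
  refine Fintype.sum_equiv ((Equiv.inv _).trans (Equiv.mulLeft p)) _ _ fun c => ?_
  simp [mul_left_comm]
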